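/- Let $d\ge 2$, let $U_1,\dots,U_M\subset\mathbb{R}^{d-1}$ be open sets, and let $\chi_i:U_i\to\mathbb{R}^d$ be $C^\infty$ embeddings (immersions that are homeomorphisms onto their images) such that each hypersurface $\chi_i(U_i)$ has nowhere vanishing Gaussian curvature. Suppose that the immersed hypersurface $$S:=\bigcup_{i=1}^M\chi_i(U_i)$$ is a nonempty compact set; the pieces $\chi_i(U_i)$ may intersect each other in any way. Let $\sigma_i$ be the surface measure on $\chi_i(U_i)$, let $m(p):=\#\{i:p\in\chi_i(U_i)\}$, and define the surface measure of $S$ by $$d\sigma_S(p):=\sum_{i=1}^M m(p)^{-1}\,d\sigma_i(p).$$ Then $\sigma_S$ admits no Fourier frame: there do not exist a discrete set $\Lambda\subset\mathbb{R}^d$ and constants $0<A\le B<\infty$ such that $$A\,\|f\|_{L^2(\sigma_S)}^2\le\sum_{\lambda\in\Lambda}\Bigl|\int e^{-2\pi i x\cdot\lambda}f(x)\,d\sigma_S(x)\Bigr|^2\le B\,\|f\|_{L^2(\sigma_S)}^2\qquad\text{for all } f\in L^1(\sigma_S)\cap L^2(\sigma_S).$$ (If $\sigma_S$ is finite, then $L^1(\sigma_S)\cap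 L^2(\sigma_S)=L^2(\sigma_S)$. In particular, the result applies to every immersion of a nonempty compact $(d-1)$-dimensional manifold with nonvanishing Gaussian curvature.) -/

import Mathlib

open MeasureTheory
open scoped ENNReal ContDiff

noncomputable section

namespace FourierFrame

/-- The Fourier transform of the complex measure `f dμ`:
`ξ ↦ ∫ e^{-2πi x·ξ} f(x) dμ(x)`. -/
def fourierTransform {d : ℕ} (μ : Measure (EuclideanSpace ℝ (Fin d)))
    (f : EuclideanSpace ℝ (Fin d) → ℂ) (ξ : EuclideanSpace ℝ (Fin d)) : ℂ :=
  ∫ x, Complex.exp (-(2 * Real.pi * inner ℝ x ξ : ℝ) * Complex.I) * f x ∂μ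

/-- `Λ` is a frame spectrum of `μ`: it is discrete and, for some `0 < A ≤ B < ∞`,
`A ‖f‖² ≤ ∑_{λ ∈ Λ} |(f dμ)^(λ)|² ≤ B ‖f‖²` for all `f ∈ L²(μ)`, the sum being taken in `[0, ∞]`.
For a finite measure `μ`, `f ∈ L²(μ)` already implies that `f` is integrable. For an infinite `μ`
the integrability clause restricts to those `f ∈ L²(μ)` whose Fourier transform is given by a
convergent integral. -/
def IsFrameSpectrum {d : ℕ} (μ : Measure (EuclideanSpace ℝ (Fin d)))
    (Λ : Set (EuclideanSpace ℝ (Fin d))) : Prop :=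
  IsDiscrete Λ ∧ ∃ A B : ℝ, 0 < A ∧ A ≤ B ∧
    ∀ f : EuclideanSpace ℝ (Fin d) → ℂ, Integrable f μ → MemLp f 2 μ →
      ENNReal.ofReal A * eLpNorm f 2 μ ^ 2 ≤ ∑' l : Λ, ‖fourierTransform μ f l‖ₑ ^ 2 ∧
      ∑' l : Λ, ‖fourierTransform μ f l‖ₑ ^ 2 ≤ ENNReal.ofReal B * eLpNorm f 2 μ ^ 2

/-- `μ` admits a Fourier frame. -/
def AdmitsFourierFrame {d : ℕ} (μ : Measure (EuclideanSpace ℝ (Fin d))) : Prop :=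
  ∃ Λ : Set (EuclideanSpace ℝ (Fin d)), IsFrameSpectrum μ Λ

/-- `χ` restricts to a smooth embedding of the open set `U ⊆ ℝⁿ` into `ℝᵈ`: a smooth immersion which
is a homeomorphism onto its image. The values of `χ` outside `U` are irrelevant. -/
structure IsSmoothEmbedding {n d : ℕ} (U : Set (EuclideanSpace ℝ (Fin n)))
    (χ : EuclideanSpace ℝ (Fin n) → EuclideanSpace ℝ (Fin d)) : Prop where
  isOpen : IsOpen U
  contDiffOn : ContDiffOn ℝ ∞ χ U
  injective_fderiv : ∀ x ∈ U, Function.Injective (fderiv ℝ χ x)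
  isEmbedding : Topology.IsEmbedding (U.domRestrict χ)

/-- The first fundamental form `(⟪∂ᵢχ, ∂ⱼχ⟫)ᵢⱼ` of `χ` at `x`. -/
def firstFundamentalForm {n d : ℕ} (χ : EuclideanSpace ℝ (Fin n) → EuclideanSpace ℝ (Fin d))
    (x : EuclideanSpace ℝ (Fin n)) : Matrix (Fin n) (Fin n) ℝ :=
  Matrix.of fun i j =>
    inner ℝ (fderiv ℝ χ x (EuclideanSpace.single i 1)) (fderiv ℝ χ x (EuclideanSpace.single j 1))

/-- The second fundamental form `(⟪∂ᵢ∂ⱼχ, ν⟫)ᵢⱼ` of `χ` at `x` with respect to the unit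
normal `ν`. -/
def secondFundamentalForm {n d : ℕ} (χ : EuclideanSpace ℝ (Fin n) → EuclideanSpace ℝ (Fin d))
    (ν : EuclideanSpace ℝ (Fin d)) (x : EuclideanSpace ℝ (Fin n)) : Matrix (Fin n) (Fin n) ℝ :=
  Matrix.of fun i j =>
    inner ℝ (fderiv ℝ (fderiv ℝ χ) x (EuclideanSpace.single i 1) (EuclideanSpace.single j 1)) ν

/-- `ν` is a unit normal of the parametrized surface `χ` at the parameter `x`. -/
def IsUnitNormal {n d : ℕ} (χ : EuclideanSpace ℝ (Fin n) → EuclideanSpace ℝ (Fin d))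
    (x : EuclideanSpace ℝ (Fin n)) (ν : EuclideanSpace ℝ (Fin d)) : Prop :=
  ‖ν‖ = 1 ∧ ∀ v, inner ℝ (fderiv ℝ χ x v) ν = 0

/-- The Gaussian curvature (product of the principal curvatures) of the parametrized hypersurface
`χ` at `x`, with respect to the unit normal `ν`. Replacing `ν` by `-ν` changes at most its sign. -/
def gaussianCurvature {n d : ℕ} (χ : EuclideanSpace ℝ (Fin n) → EuclideanSpace ℝ (Fin d))
    (ν : EuclideanSpace ℝ (Fin d)) (x : EuclideanSpace ℝ (Fin n)) : ℝ :=
  (secondFundamentalForm χ ν x).det / (firstFundamentalForm χ x).det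

/-- The hypersurface `χ(U)` has nonvanishing Gaussian curvature. -/
def HasNonvanishingGaussianCurvature {n d : ℕ} (U : Set (EuclideanSpace ℝ (Fin n)))
    (χ : EuclideanSpace ℝ (Fin n) → EuclideanSpace ℝ (Fin d)) : Prop :=
  ∀ x ∈ U, ∀ ν, IsUnitNormal χ x ν → gaussianCurvature χ ν x ≠ 0

/-- The surface measure of the parametrized surface `χ(U)`: the push-forward under `χ` of
`√(det I) dx` on `U`, where `I` is the first fundamental form. -/
def patchMeasure {n d : ℕ} (U : Set (EuclideanSpace ℝ (Fin n)))
    (χ : EuclideanSpace ℝ (Fin n) → EuclideanSpace ℝ (Fin d)) :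
    Measure (EuclideanSpace ℝ (Fin d)) :=
  ((volume.restrict U).withDensity fun x =>
    ENNReal.ofReal (Real.sqrt (firstFundamentalForm χ x).det)).map χ

/-- The surface `S = ⋃ᵢ χᵢ(Uᵢ)`. -/
def surface {n d M : ℕ} (U : Fin M → Set (EuclideanSpace ℝ (Fin n)))
    (χ : Fin M → EuclideanSpace ℝ (Fin n) → EuclideanSpace ℝ (Fin d)) :
    Set (EuclideanSpace ℝ (Fin d)) :=
  ⋃ i, χ i '' U i

/-- The multiplicity function `m(p) = #{i : p ∈ χᵢ(Uᵢ)}`. -/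
def multiplicity {n d M : ℕ} (U : Fin M → Set (EuclideanSpace ℝ (Fin n)))
    (χ : Fin M → EuclideanSpace ℝ (Fin n) → EuclideanSpace ℝ (Fin d))
    (p : EuclideanSpace ℝ (Fin d)) : ℕ :=
  {i : Fin M | p ∈ χ i '' U i}.ncard

/-- The surface measure `dσ_S = ∑ᵢ m(p)⁻¹ dσᵢ` of `S = ⋃ᵢ χᵢ(Uᵢ)`. -/
def surfaceMeasure {n d M : ℕ} (U : Fin M → Set (EuclideanSpace ℝ (Fin n)))
    (χ : Fin M → EuclideanSpace ℝ (Fin n) → EuclideanSpace ℝ (Fin d)) :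
    Measure (EuclideanSpace ℝ (Fin d)) :=
  ∑ i, (patchMeasure (U i) (χ i)).withDensity fun p => ((multiplicity U χ p : ℕ) : ℝ≥0∞)⁻¹

end FourierFrame

end

/-! Write `n = d - 1`. The upper frame bound makes the frame spectrum sparse, and the lower bound
cannot hold for so sparse a set.

Sparseness. For a unit vector `ζ`, compactness of the surface gives a point maximising `x · ζ`;
there `ζ` is normal and, by curvature, the phase `χ · ζ` has nondegenerate Hessian. A bump on one
patch around this point has a transform with `|f^(Tζ')|² ≥ c T^{-n}` for large `T` and `ζ'` near `ζ`
(`exists_le_fourierTransform`). Finitely many directions cover the sphere, and modulated test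
functions control bounded regions, so `∑ (1 + |λ|)^{-n} < ∞` over the spectrum
(`weightSum_univ_lt_top`).

Contradiction. Some bump has `|f^(ξ)|² ≤ C (1 + |ξ|)^{-n}` and `f^(0) ≠ 0`
(`exists_fourierTransform_decay`). Modulation translates `f^` and preserves the norm, so the lower
bound forces `∑ (1 + |λ - ξ|)^{-n}` to stay above a fixed positive constant for every `ξ`. Averaged
over `|ξ| < R`, each term is at most a constant times `(1 + |λ|)^{-n}` and tends to `0` as `R → ∞`;
dominated convergence makes the averaged sum tend to `0` (`exists_tsum_decayWeight_sub_lt`).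

Both transform estimates come from squaring. The quantity `|∫ e^{-2πi χ·ξ} b|²` is the integral over
`v` of correlations with phase `(χ(y+v) - χ(y)) · ξ`. For a nondegenerate Hessian this phase has no
critical point when `v ≠ 0` is local, so nonstationary phase gives rapid decay at scale `|v| ~ 1/T`.
Integrating gives the upper bound; passing to the limit `T → ∞` and evaluating with a Gaussian
regulariser gives the lower one. -/

namespace FourierFrame

open Set Filter Topology Metric

/-! ### Families of functions with uniformly bounded directional derivatives -/

section UniformlySmooth

variable {ι E : Type*} [NormedAddCommGroup E] [NormedSpace ℝ E]

/-- The functions `f i` have directional derivatives along `e` of order at most `k` which are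
bounded uniformly in `i`. -/
def UnifBounded (e : E) : ℕ → (ι → E → ℝ) → Prop
  | 0, f => ∃ C, ∀ i x, |f i x| ≤ C
  | k + 1, f => (∃ C, ∀ i x, |f i x| ≤ C) ∧ UnifBounded e k fun i x => fderiv ℝ (f i) x e

/-- A family of smooth functions all of whose directional derivatives along `e` are bounded,
uniformly over the family. -/
structure UnifSmooth (e : E) (f : ι → E → ℝ) : Prop where
  contDiff : ∀ i, ContDiff ℝ ∞ (f i)
  bounded : ∀ k, UnifBounded e k f

theorem UnifBounded.exists_bound {e : E} {k : ℕ} {f : ι → E → ℝ} (h : UnifBounded e k f) :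
    ∃ C, ∀ i x, |f i x| ≤ C := by
  cases k with
  | zero => exact h
  | succ k => exact h.1

theorem UnifBounded.pred {e : E} {k : ℕ} {f : ι → E → ℝ} (h : UnifBounded e (k + 1) f) :
    UnifBounded e k f := by
  induction k generalizing f with
  | zero => exact h.1
  | succ k ih => exact ⟨h.1, ih h.2⟩

theorem contDiff_fderiv_apply {F : Type*} [NormedAddCommGroup F] [NormedSpace ℝ F] {f : E → F}
    (hf : ContDiff ℝ ∞ f) (e : E) : ContDiff ℝ ∞ fun x => fderiv ℝ f x e :=
  (hf.fderiv_right (m := ∞) (by simp)).clm_apply contDiff_const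

theorem UnifSmooth.deriv {e : E} {f : ι → E → ℝ} (h : UnifSmooth e f) :
    UnifSmooth e fun i x => fderiv ℝ (f i) x e :=
  ⟨fun i => contDiff_fderiv_apply (h.contDiff i) e, fun k => (h.bounded (k + 1)).2⟩

theorem UnifBounded.add {e : E} {k : ℕ} {f g : ι → E → ℝ} (hf : UnifBounded e k f)
    (hg : UnifBounded e k g) (hf' : ∀ i, ContDiff ℝ ∞ (f i)) (hg' : ∀ i, ContDiff ℝ ∞ (g i)) :
    UnifBounded e k fun i x => f i x + g i x := by
  have h0 : ∃ C, ∀ i x, |f i x + g i x| ≤ C := by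
    obtain ⟨C, hC⟩ := hf.exists_bound
    obtain ⟨D, hD⟩ := hg.exists_bound
    exact ⟨C + D, fun i x => (abs_add_le _ _).trans (add_le_add (hC i x) (hD i x))⟩
  induction k generalizing f g with
  | zero => exact h0
  | succ k ih =>
    refine ⟨h0, ?_⟩
    have : (fun i x => fderiv ℝ (fun x => f i x + g i x) x e) =
        fun i x => fderiv ℝ (f i) x e + fderiv ℝ (g i) x e := by
      ext i x
      rw [fderiv_fun_add ((hf' i).differentiable (by simp) x)
        ((hg' i).differentiable (by simp) x)]
      rfl
    rw [this]
    have h1 := hf.2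
    have h2 := hg.2
    refine ih h1 h2 (fun i => contDiff_fderiv_apply (hf' i) e)
      (fun i => contDiff_fderiv_apply (hg' i) e) ?_
    obtain ⟨C, hC⟩ := h1.exists_bound
    obtain ⟨D, hD⟩ := h2.exists_bound
    exact ⟨C + D, fun i x => (abs_add_le _ _).trans (add_le_add (hC i x) (hD i x))⟩

theorem UnifBounded.mul {e : E} {k : ℕ} {f g : ι → E → ℝ} (hf : UnifBounded e k f)
    (hg : UnifBounded e k g) (hf' : ∀ i, ContDiff ℝ ∞ (f i)) (hg' : ∀ i, ContDiff ℝ ∞ (g i)) :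
    UnifBounded e k fun i x => f i x * g i x := by
  induction k generalizing f g with
  | zero =>
    obtain ⟨C, hC⟩ := hf
    obtain ⟨D, hD⟩ := hg
    refine ⟨C * D, fun i x => ?_⟩
    rw [abs_mul]
    exact mul_le_mul (hC i x) (hD i x) (abs_nonneg _) ((abs_nonneg _).trans (hC i x))
  | succ k ih =>
    refine ⟨(ih hf.pred hg.pred hf' hg').exists_bound, ?_⟩
    have : (fun i x => fderiv ℝ (fun x => f i x * g i x) x e) =
        fun i x => f i x * fderiv ℝ (g i) x e + g i x * fderiv ℝ (f i) x e := by
      ext i x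
      rw [fderiv_fun_mul ((hf' i).differentiable (by simp) x)
        ((hg' i).differentiable (by simp) x)]
      rfl
    rw [this]
    have hf1 := fun i => contDiff_fderiv_apply (hf' i) e
    have hg1 := fun i => contDiff_fderiv_apply (hg' i) e
    exact (ih hf.pred hg.2 hf' hg1).add (ih hg.pred hf.2 hg' hf1)
      (fun i => (hf' i).mul (hg1 i)) (fun i => (hg' i).mul (hf1 i))

theorem UnifSmooth.mul {e : E} {f g : ι → E → ℝ} (hf : UnifSmooth e f) (hg : UnifSmooth e g) :
    UnifSmooth e fun i x => f i x * g i x :=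
  ⟨fun i => (hf.contDiff i).mul (hg.contDiff i),
    fun k => (hf.bounded k).mul (hg.bounded k) hf.contDiff hg.contDiff⟩

/-- No global bound on `κ` is needed, because all values of the family lie in one compact interval.
The chain rule produces `κ' ∘ f` times a derivative of `f`, so the induction must vary `κ`. -/
theorem UnifBounded.comp {e : E} {k : ℕ} {f : ι → E → ℝ} (hf : UnifBounded e k f)
    (hf' : ∀ i, ContDiff ℝ ∞ (f i)) {κ : ℝ → ℝ} (hκ : ContDiff ℝ ∞ κ) :
    UnifBounded e k fun i x => κ (f i x) := by
  induction k generalizing κ with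
  | zero =>
    obtain ⟨C, hC⟩ := hf
    obtain ⟨D, hD⟩ := (isCompact_Icc (a := -C) (b := C)).exists_bound_of_continuousOn
      hκ.continuous.continuousOn
    exact ⟨D, fun i x => hD _ (abs_le.1 (hC i x))⟩
  | succ k ih =>
    have hκ' : ContDiff ℝ ∞ (_root_.deriv κ) := (contDiff_infty_iff_deriv.1 hκ).2
    refine ⟨(ih hf.pred hκ).exists_bound, ?_⟩
    have : (fun i x => fderiv ℝ (fun x => κ (f i x)) x e) =
        fun i x => _root_.deriv κ (f i x) * fderiv ℝ (f i) x e := by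
      ext i x
      have h := ((hκ.differentiable (by simp) (f i x)).hasDerivAt).comp_hasFDerivAt x
        ((hf' i).differentiable (by simp) x).hasFDerivAt
      have h2 : fderiv ℝ (fun x => κ (f i x)) x = _ := h.fderiv
      rw [h2]
      rfl
    rw [this]
    exact (ih hf.pred hκ').mul hf.2 (fun i => hκ'.comp (hf' i))
      (fun i => contDiff_fderiv_apply (hf' i) e)

theorem UnifSmooth.comp {e : E} {f : ι → E → ℝ} (hf : UnifSmooth e f) {κ : ℝ → ℝ}
    (hκ : ContDiff ℝ ∞ κ) : UnifSmooth e fun i x => κ (f i x) :=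
  ⟨fun i => hκ.comp (hf.contDiff i), fun k => (hf.bounded k).comp hf.contDiff hκ⟩

/-- A smooth function on `ℝ` which agrees with `y ↦ y⁻¹` on `[c, ∞)`. -/
theorem exists_smooth_inv {c : ℝ} (hc : 0 < c) :
    ∃ κ : ℝ → ℝ, ContDiff ℝ ∞ κ ∧ ∀ y, c ≤ y → κ y * y = 1 := by
  -- The argument `2y/c - 1` is nonpositive for `y ≤ c/2`, which removes the pole at `0`, and at
  -- least `1` for `y ≥ c`.
  refine ⟨fun y => Real.smoothTransition (2 * y / c - 1) * y⁻¹, ?_, fun y hy => ?_⟩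
  · rw [contDiff_iff_contDiffAt]
    intro y
    have h1 : ContDiff ℝ ∞ fun y : ℝ => Real.smoothTransition (2 * y / c - 1) :=
      Real.smoothTransition.contDiff.comp (by fun_prop)
    rcases eq_or_ne y 0 with rfl | hy
    · have : (fun y => Real.smoothTransition (2 * y / c - 1) * y⁻¹) =ᶠ[𝓝 0] fun _ => 0 := by
        filter_upwards [eventually_lt_nhds (show (0 : ℝ) < c / 2 by positivity)] with y hy
        rw [Real.smoothTransition.zero_of_nonpos, zero_mul]
        rw [sub_nonpos, div_le_one hc]
        linarith
      exact contDiffAt_const.congr_of_eventuallyEq this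
    · exact h1.contDiffAt.mul (contDiffAt_id.inv hy)
  · have hy0 : y ≠ 0 := (hc.trans_le hy).ne'
    simp only
    rw [Real.smoothTransition.one_of_one_le, one_mul, inv_mul_cancel₀ hy0]
    rw [le_sub_iff_add_le, le_div_iff₀ hc]
    linarith

end UniformlySmooth

/-! ### The oscillating factor -/

/-- The character `t ↦ e^{-2πit}`. -/
noncomputable def osc (t : ℝ) : ℂ := Complex.exp (-(2 * Real.pi * t : ℝ) * Complex.I)

@[simp] theorem norm_osc (t : ℝ) : ‖osc t‖ = 1 := by
  rw [osc, ← Complex.ofReal_neg, Complex.norm_exp_ofReal_mul_I]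

@[simp] theorem osc_zero : osc 0 = 1 := by simp [osc]

theorem osc_add (s t : ℝ) : osc (s + t) = osc s * osc t := by
  rw [osc, osc, osc, ← Complex.exp_add]
  congr 1
  push_cast
  ring

theorem conj_osc (t : ℝ) : (starRingEnd ℂ) (osc t) = osc (-t) := by
  rw [osc, osc, ← Complex.exp_conj, map_mul, map_neg, Complex.conj_ofReal, Complex.conj_I]
  congr 1
  push_cast
  ring

theorem contDiff_osc : ContDiff ℝ ∞ osc := by
  refine Complex.contDiff_exp.comp (ContDiff.mul (ContDiff.neg ?_) contDiff_const)
  exact Complex.ofRealCLM.contDiff.comp (contDiff_const.mul contDiff_id)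

theorem continuous_osc : Continuous osc := contDiff_osc.continuous

theorem hasDerivAt_osc (t : ℝ) : HasDerivAt osc (osc t * (-(2 * Real.pi : ℝ) * Complex.I)) t := by
  have h : HasDerivAt (fun t : ℝ => -((2 * Real.pi * t : ℝ) : ℂ) * Complex.I)
      (-(2 * Real.pi : ℝ) * Complex.I) t := by
    have := ((hasDerivAt_id t).const_mul (2 * Real.pi)).ofReal_comp.neg.mul_const Complex.I
    simpa using this
  exact h.cexp

theorem fderiv_osc_comp {E : Type*} [NormedAddCommGroup E] [NormedSpace ℝ E]
    {Ψ : E → ℝ} (hΨ : Differentiable ℝ Ψ) (τ : ℝ) (x e : E) :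
    fderiv ℝ (fun y => osc (τ * Ψ y)) x e =
      (-(2 * Real.pi * τ : ℝ) * Complex.I) * (osc (τ * Ψ x) * (fderiv ℝ Ψ x e : ℝ)) := by
  have h := (hasDerivAt_osc (τ * Ψ x)).hasFDerivAt.comp x ((hΨ x).hasFDerivAt.const_mul τ)
  have h2 : fderiv ℝ (fun y => osc (τ * Ψ y)) x = _ := h.fderiv
  rw [h2]
  simp
  ring

/-! ### Nonstationary phase by repeated integration by parts -/

section NonstationaryPhase

variable {ι E : Type*} [NormedAddCommGroup E] [NormedSpace ℝ E] [MeasurableSpace E] [BorelSpace E]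
  [FiniteDimensional ℝ E] {μ : Measure E} [μ.IsAddHaarMeasure]

/-- Integration by parts against an oscillating factor. -/
theorem norm_integral_osc_mul_fderiv_le {Ψ : E → ℝ} (hΨ : ContDiff ℝ ∞ Ψ) {g : E → ℝ}
    (hg : ContDiff ℝ ∞ g) (hgc : HasCompactSupport g) {τ : ℝ} (hτ : 0 < τ) (e : E) :
    ‖∫ x, osc (τ * Ψ x) * ((g x * fderiv ℝ Ψ x e : ℝ) : ℂ) ∂μ‖ ≤
      τ⁻¹ * ‖∫ x, osc (τ * Ψ x) * ((fderiv ℝ g x e : ℝ) : ℂ) ∂μ‖ := by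
  have hΨd : Differentiable ℝ Ψ := hΨ.differentiable (by simp)
  have hgd : Differentiable ℝ g := hg.differentiable (by simp)
  have hf : ContDiff ℝ ∞ fun y => osc (τ * Ψ y) := contDiff_osc.comp (contDiff_const.mul hΨ)
  have hG : ContDiff ℝ ∞ fun y => (g y : ℂ) := Complex.ofRealCLM.contDiff.comp hg
  have hGc : HasCompactSupport fun y => (g y : ℂ) := hgc.comp_left (g := fun t : ℝ => (t : ℂ)) rfl
  have hfg : ∀ x, fderiv ℝ (fun y => (g y : ℂ)) x e = ((fderiv ℝ g x e : ℝ) : ℂ) := by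
    intro x
    have h := (Complex.ofRealCLM.hasFDerivAt (x := g x)).comp x (hgd x).hasFDerivAt
    have h2 : fderiv ℝ (fun y => (g y : ℂ)) x = _ := h.fderiv
    rw [h2]
    simp
  have hGc' : HasCompactSupport fun x => fderiv ℝ (fun y => (g y : ℂ)) x e :=
    hGc.fderiv_apply ℝ e
  have hparts := integral_mul_fderiv_eq_neg_fderiv_mul_of_integrable (μ := μ) (v := e)
    (f := fun y => osc (τ * Ψ y)) (g := fun y => (g y : ℂ))
    (((contDiff_fderiv_apply hf e).continuous.mul hG.continuous).integrable_of_hasCompactSupport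
      hGc.mul_left)
    ((hf.continuous.mul (contDiff_fderiv_apply hG e).continuous).integrable_of_hasCompactSupport
      hGc'.mul_left)
    ((hf.continuous.mul hG.continuous).integrable_of_hasCompactSupport hGc.mul_left)
    (fun x _ => hf.differentiable (by simp) x) (fun x _ => hG.differentiable (by simp) x)
  have h1 : ∫ x, fderiv ℝ (fun y => osc (τ * Ψ y)) x e * (g x : ℂ) ∂μ =
      (-(2 * Real.pi * τ : ℝ) * Complex.I) *
        ∫ x, osc (τ * Ψ x) * ((g x * fderiv ℝ Ψ x e : ℝ) : ℂ) ∂μ := by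
    rw [← integral_const_mul]
    congr 1
    ext x
    rw [fderiv_osc_comp hΨd]
    push_cast
    ring
  simp only [hfg] at hparts
  rw [hparts, norm_neg, h1, norm_mul]
  have h2 : ‖(-(2 * Real.pi * τ : ℝ) * Complex.I : ℂ)‖ = 2 * Real.pi * τ := by
    rw [norm_mul, norm_neg, Complex.norm_real, Complex.norm_I, mul_one, Real.norm_of_nonneg]
    positivity
  rw [h2, ← mul_assoc]
  -- The true gain is `(2πτ)⁻¹`; the factor `2π ≥ 1` is discarded.
  refine le_mul_of_one_le_left (norm_nonneg _) ?_
  rw [show τ⁻¹ * (2 * Real.pi * τ) = 2 * Real.pi by field_simp]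
  linarith [Real.pi_gt_three]

/-- Nonstationary phase, uniformly over a family of phases and amplitudes. -/
theorem exists_norm_integral_osc_le {e : E} {Ψ a : ι → E → ℝ} (hΨ : ∀ i, ContDiff ℝ ∞ (Ψ i))
    (hΨ' : UnifSmooth e fun i x => fderiv ℝ (Ψ i) x e) (ha : UnifSmooth e a) {K : Set E}
    (hK : IsCompact K) (haK : ∀ i, tsupport (a i) ⊆ K) {c : ℝ} (hc : 0 < c)
    (hcΨ : ∀ i, ∀ x ∈ tsupport (a i), c ≤ fderiv ℝ (Ψ i) x e) (N : ℕ) :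
    ∃ C, ∀ i, ∀ τ > 0, ‖∫ x, osc (τ * Ψ i x) * (a i x : ℂ) ∂μ‖ ≤ C * (τ ^ N)⁻¹ := by
  induction N generalizing a with
  | zero =>
    obtain ⟨C, hC⟩ := (ha.bounded 0).exists_bound
    refine ⟨C * μ.real K, fun i τ _ => ?_⟩
    have h : ∫ x, osc (τ * Ψ i x) * (a i x : ℂ) ∂μ =
        ∫ x in K, osc (τ * Ψ i x) * (a i x : ℂ) ∂μ := by
      refine (setIntegral_eq_integral_of_forall_compl_eq_zero fun x hx => ?_).symm
      rw [image_eq_zero_of_notMem_tsupport fun h => hx (haK i h)]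
      simp
    rw [h, pow_zero, inv_one, mul_one]
    refine norm_setIntegral_le_of_norm_le_const hK.measure_lt_top fun x _ => ?_
    rw [norm_mul, norm_osc, one_mul, Complex.norm_real]
    exact hC i x
  | succ N ih =>
    -- Integration by parts requires dividing the amplitude by `∂ₑΨ`. The function `κ(∂ₑΨ)` equals
    -- `1/∂ₑΨ` on the support of `a` and is smooth everywhere, so the new amplitude `∂ₑ(a κ(∂ₑΨ))`
    -- satisfies the same hypotheses with no larger support.
    obtain ⟨κ, hκ, hκ1⟩ := exists_smooth_inv hc
    have hg : UnifSmooth e fun i x => a i x * κ (fderiv ℝ (Ψ i) x e) := ha.mul (hΨ'.comp hκ)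
    have hsub : ∀ i, tsupport (fun x => a i x * κ (fderiv ℝ (Ψ i) x e)) ⊆ tsupport (a i) :=
      fun i => tsupport_mul_subset_left
    have hsub' : ∀ i, tsupport (fun x => fderiv ℝ (fun x => a i x * κ (fderiv ℝ (Ψ i) x e)) x e) ⊆
        tsupport (a i) := fun i => (tsupport_fderiv_apply_subset ℝ e).trans (hsub i)
    obtain ⟨C, hC⟩ := ih hg.deriv (fun i => (hsub' i).trans (haK i))
      (fun i x hx => hcΨ i x (hsub' i hx))
    refine ⟨C, fun i τ hτ => ?_⟩
    have h1 : ∀ x, a i x = a i x * κ (fderiv ℝ (Ψ i) x e) * fderiv ℝ (Ψ i) x e := by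
      intro x
      by_cases hx : x ∈ tsupport (a i)
      · rw [mul_assoc, hκ1 _ (hcΨ i x hx), mul_one]
      · rw [image_eq_zero_of_notMem_tsupport hx]
        simp
    have h2 : HasCompactSupport fun x => a i x * κ (fderiv ℝ (Ψ i) x e) :=
      HasCompactSupport.of_support_subset_isCompact hK
        ((subset_tsupport _).trans ((hsub i).trans (haK i)))
    have h3 := norm_integral_osc_mul_fderiv_le (μ := μ) (hΨ i) (hg.contDiff i) h2 hτ e
    calc _ = ‖∫ x, osc (τ * Ψ i x) *
          ((a i x * κ (fderiv ℝ (Ψ i) x e) * fderiv ℝ (Ψ i) x e : ℝ) : ℂ) ∂μ‖ := by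
          simp_rw [← h1]
      _ ≤ _ := h3
      _ ≤ τ⁻¹ * (C * (τ ^ N)⁻¹) := by gcongr; exact hC i τ hτ
      _ = C * (τ ^ (N + 1))⁻¹ := by rw [pow_succ, mul_inv]; ring

end NonstationaryPhase

/-! ### Uniform bounds for phases and their difference quotients -/

section InnerDerivatives

variable {E F : Type*} [NormedAddCommGroup E] [NormedSpace ℝ E]
  [NormedAddCommGroup F] [InnerProductSpace ℝ F]

theorem fderiv_inner_const {g : E → F} (hg : Differentiable ℝ g) (ζ : F) (x e : E) :
    fderiv ℝ (fun y => inner ℝ (g y) ζ) x e = inner ℝ (fderiv ℝ g x e) ζ := by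
  rw [fderiv_inner_apply ℝ (hg x) (differentiableAt_const ζ)]
  simp

theorem fderiv_diffQuot {g : E → F} (hg : Differentiable ℝ g) (v : E) (ζ : F) (s : ℝ) (x e : E) :
    fderiv ℝ (fun y => inner ℝ (g (y + v) - g y) ζ / s) x e =
      inner ℝ (fderiv ℝ g (x + v) e - fderiv ℝ g x e) ζ / s := by
  have h1 : Differentiable ℝ fun y => g (y + v) := hg.comp (by fun_prop)
  have h2 : Differentiable ℝ fun y => g (y + v) - g y := h1.sub hg
  simp only [div_eq_mul_inv]
  rw [fderiv_mul_const ((h2 x).inner ℝ (differentiableAt_const _)), smul_apply,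
    fderiv_inner_const h2, fderiv_fun_sub (h1 x) (hg x), fderiv_comp_add_right, smul_eq_mul,
    mul_comm]
  rfl

theorem unifBounded_inner {ι : Type*} {g : E → F} (hg : ContDiff ℝ ∞ g) (hgc : HasCompactSupport g)
    {ζ : ι → F} {B : ℝ} (hζ : ∀ i, ‖ζ i‖ ≤ B) (e : E) (k : ℕ) :
    UnifBounded e k fun i y => inner ℝ (g y) (ζ i) := by
  have h0 : ∀ {g : E → F}, ContDiff ℝ ∞ g → HasCompactSupport g →
      ∃ C, ∀ i x, |inner ℝ (g x) (ζ i)| ≤ C := by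
    intro g hg hgc
    obtain ⟨C, hC⟩ := hgc.exists_bound_of_continuous hg.continuous
    refine ⟨C * B, fun i x => (abs_real_inner_le_norm _ _).trans ?_⟩
    exact mul_le_mul (hC x) (hζ i) (norm_nonneg _) ((norm_nonneg _).trans (hC x))
  induction k generalizing g with
  | zero => exact h0 hg hgc
  | succ k ih =>
    refine ⟨h0 hg hgc, ?_⟩
    simp only [fderiv_inner_const (hg.differentiable (by simp))]
    exact ih (contDiff_fderiv_apply hg e) (hgc.fderiv_apply ℝ e)

/-- Dividing by arbitrarily small `s` costs nothing: the mean value inequality provides a factor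
`s`. Differentiating along `e` gives the difference quotient of `∂ₑg`, to which the induction
applies. -/
theorem unifBounded_diffQuot {ι : Type*} {g : E → F} (hg : ContDiff ℝ ∞ g)
    (hgc : HasCompactSupport g) {s : ι → ℝ} {θ : ι → E} {ζ : ι → F} {A B : ℝ} (hs : ∀ i, 0 < s i)
    (hθ : ∀ i, ‖θ i‖ ≤ A) (hζ : ∀ i, ‖ζ i‖ ≤ B) (e : E) (k : ℕ) :
    UnifBounded e k fun i y => inner ℝ (g (y + s i • θ i) - g y) (ζ i) / s i := by
  have h0 : ∀ {g : E → F}, ContDiff ℝ ∞ g → HasCompactSupport g →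
      ∃ C, ∀ i x, |inner ℝ (g (x + s i • θ i) - g x) (ζ i) / s i| ≤ C := by
    intro g hg hgc
    obtain ⟨C, hC⟩ := (hgc.fderiv ℝ).exists_bound_of_continuous (hg.continuous_fderiv (by simp))
    refine ⟨C * A * B, fun i x => ?_⟩
    have hC0 : 0 ≤ C := (norm_nonneg _).trans (hC x)
    have hA0 : 0 ≤ A := (norm_nonneg _).trans (hθ i)
    have h1 : ‖g (x + s i • θ i) - g x‖ ≤ C * ‖x + s i • θ i - x‖ :=
      convex_univ.norm_image_sub_le_of_norm_fderiv_le
        (fun y _ => hg.differentiable (by simp) y) (fun y _ => hC y) (mem_univ _) (mem_univ _)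
    rw [add_sub_cancel_left, norm_smul, Real.norm_of_nonneg (hs i).le] at h1
    rw [abs_div, abs_of_pos (hs i), div_le_iff₀ (hs i)]
    calc _ ≤ ‖g (x + s i • θ i) - g x‖ * ‖ζ i‖ := abs_real_inner_le_norm _ _
      _ ≤ (C * (s i * A)) * B := by
        refine mul_le_mul (h1.trans ?_) (hζ i) (norm_nonneg _) (by have := (hs i).le; positivity)
        gcongr
        · exact (hs i).le
        · exact hθ i
      _ = _ := by ring
  induction k generalizing g with
  | zero => exact h0 hg hgc
  | succ k ih =>
    refine ⟨h0 hg hgc, ?_⟩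
    have : (fun i x => fderiv ℝ (fun y => inner ℝ (g (y + s i • θ i) - g y) (ζ i) / s i) x e) =
        fun i x => inner ℝ (fderiv ℝ g (x + s i • θ i) e - fderiv ℝ g x e) (ζ i) / s i := by
      ext i x
      exact fderiv_diffQuot (hg.differentiable (by simp)) _ _ _ _ _
    rw [this]
    exact ih (contDiff_fderiv_apply hg e) (hgc.fderiv_apply ℝ e)

end InnerDerivatives

/-! ### Upper bounds for oscillatory integrals via correlations -/

section OscillatoryIntegrals

variable {E F : Type*} [NormedAddCommGroup E] [InnerProductSpace ℝ E] [FiniteDimensional ℝ E]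
  [NormedAddCommGroup F] [InnerProductSpace ℝ F]
  [MeasurableSpace E] [BorelSpace E]

/-- The oscillatory integral `∫ e^{-2πi χ(y)·ξ} b(y) dy`. -/
noncomputable def oscInt (χ : E → F) (b : E → ℝ) (ξ : F) : ℂ :=
  ∫ y, osc (inner ℝ (χ y) ξ) * (b y : ℂ)

/-- The correlation `∫ e^{-2πi (χ(y+v)-χ(y))·ξ} b(y+v) b(y) dy`. -/
noncomputable def corr (χ : E → F) (b : E → ℝ) (v : E) (ξ : F) : ℂ :=
  ∫ y, osc (inner ℝ (χ (y + v) - χ y) ξ) * ((b (y + v) * b y : ℝ) : ℂ)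

/-- Expand the square as a double integral, substitute `x = y + v` and apply Fubini. This trades a
phase with a critical point for phase differences, which near a nondegenerate point have none when
`v ≠ 0`. -/
theorem norm_sq_oscInt {χ : E → F} (hχ : Continuous χ) {b : E → ℝ} (hb : Continuous b)
    (hbc : HasCompactSupport b) (ξ : F) :
    ((‖oscInt χ b ξ‖ ^ 2 : ℝ) : ℂ) = ∫ v, corr χ b v ξ := by
  set f : E → ℂ := fun y => osc (inner ℝ (χ y) ξ) * (b y : ℂ) with hf
  have hosc : Continuous fun y => osc (inner ℝ (χ y) ξ) :=
    continuous_osc.comp (hχ.inner continuous_const)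
  have hfc : Continuous f := hosc.mul (Complex.continuous_ofReal.comp hb)
  have hfs : HasCompactSupport f :=
    (hbc.comp_left (g := fun t : ℝ => (t : ℂ)) rfl).mul_left
  have hfi : Integrable f := hfc.integrable_of_hasCompactSupport hfs
  have hkey : ∀ y v, f (y + v) * (starRingEnd ℂ) (f y) =
      osc (inner ℝ (χ (y + v) - χ y) ξ) * ((b (y + v) * b y : ℝ) : ℂ) := by
    intro y v
    simp only [hf, map_mul, conj_osc, Complex.conj_ofReal]
    rw [inner_sub_left, sub_eq_add_neg, osc_add]
    push_cast
    ring
  have hint : Integrable (fun p : E × E => f (p.1 + p.2) * (starRingEnd ℂ) (f p.1))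
      ((volume : Measure E).prod volume) := by
    have h1 : Integrable (fun p : E × E => (starRingEnd ℂ) (f p.1) * f p.2)
        ((volume : Measure E).prod volume) :=
      Integrable.mul_prod (f := fun y => (starRingEnd ℂ) (f y))
        ((Complex.conjLIE.toContinuousLinearEquiv.integrable_comp_iff).2 hfi) hfi
    have h2 := (measurePreserving_prod_add (volume : Measure E) volume).integrable_comp_of_integrable h1
    refine h2.congr (ae_of_all _ fun p => ?_)
    simp [mul_comm]
  calc ((‖oscInt χ b ξ‖ ^ 2 : ℝ) : ℂ) = (∫ x, f x) * (starRingEnd ℂ) (∫ y, f y) := by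
        rw [Complex.mul_conj, Complex.normSq_eq_norm_sq]
        rfl
    _ = ∫ y, (∫ v, f (y + v)) * (starRingEnd ℂ) (f y) := by
        simp_rw [integral_add_left_eq_self f, integral_const_mul, integral_conj]
    _ = ∫ y, ∫ v, f (y + v) * (starRingEnd ℂ) (f y) := by
        simp_rw [integral_mul_const]
    _ = ∫ v, ∫ y, f (y + v) * (starRingEnd ℂ) (f y) := integral_integral_swap hint
    _ = ∫ v, corr χ b v ξ := by simp_rw [hkey]; rfl

/-- The substitution `v = w / T` absorbs the power of `T`; at this scale the correlations have an
integrable majorant independent of `T`. -/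
theorem norm_sq_oscInt_smul {χ : E → F} (hχ : Continuous χ) {b : E → ℝ} (hb : Continuous b)
    (hbc : HasCompactSupport b) {T : ℝ} (hT : 0 < T) (ζ : F) :
    ((T ^ Module.finrank ℝ E * ‖oscInt χ b (T • ζ)‖ ^ 2 : ℝ) : ℂ) =
      ∫ w, corr χ b (T⁻¹ • w) (T • ζ) := by
  rw [Measure.integral_comp_smul volume (fun v => corr χ b v (T • ζ)), Complex.ofReal_mul,
    norm_sq_oscInt hχ hb hbc, inv_pow, inv_inv, abs_of_pos (by positivity), Complex.real_smul]

theorem exists_norm_corr_le {χ : E → F} {b : E → ℝ} (hb : Continuous b)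
    (hbc : HasCompactSupport b) : ∃ D, ∀ v ξ, ‖corr χ b v ξ‖ ≤ D := by
  obtain ⟨C, hC⟩ := hbc.exists_bound_of_continuous hb
  refine ⟨∫ y, C * ‖b y‖, fun v ξ => norm_integral_le_of_norm_le
    ((hb.integrable_of_hasCompactSupport hbc).norm.const_mul C) (ae_of_all _ fun y => ?_)⟩
  rw [norm_mul, norm_osc, one_mul, Complex.norm_real, norm_mul]
  exact mul_le_mul_of_nonneg_right (hC _) (norm_nonneg _)

/-- The `e`-derivative of the phase is the mean of `D²χ(θ, e) · ζ` over the segment from `y` to `y +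
sθ`. It stays above a positive constant near `(u₀, θ₀, ζ₀)`, whatever `s > 0`, so nonstationary
phase applies uniformly. -/
theorem exists_norm_corr_le_near {χ : E → F} (hχ : ContDiff ℝ ∞ χ) (hχc : HasCompactSupport χ)
    {u₀ θ₀ e : E} {ζ₀ : F} (h : 0 < inner ℝ (fderiv ℝ (fun y => fderiv ℝ χ y e) u₀ θ₀) ζ₀) :
    ∃ V ∈ 𝓝 θ₀, ∃ r > 0, ∃ W ∈ 𝓝 ζ₀, ∀ b : E → ℝ, ContDiff ℝ ∞ b →
      tsupport b ⊆ closedBall u₀ r → ∀ N : ℕ, ∃ C, ∀ s > 0, ∀ θ ∈ V, ∀ ζ ∈ W, ∀ τ > 0,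
        ‖∫ y, osc (τ * (inner ℝ (χ (y + s • θ) - χ y) ζ / s)) *
          ((b (y + s • θ) * b y : ℝ) : ℂ)‖ ≤ C * (τ ^ N)⁻¹ := by
  set G : E → F := fun y => fderiv ℝ χ y e with hG
  have hGs : ContDiff ℝ ∞ G := contDiff_fderiv_apply hχ e
  have hGd : Differentiable ℝ G := hGs.differentiable (by simp)
  have hcont : Continuous fun p : E × E × F => inner ℝ (fderiv ℝ G p.1 p.2.1) p.2.2 :=
    (((hGs.continuous_fderiv (by simp)).comp continuous_fst).clm_apply
      (continuous_fst.comp continuous_snd)).inner (continuous_snd.comp continuous_snd)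
  obtain ⟨c, hc0, hc⟩ := exists_between h
  have hev := (hcont.tendsto (u₀, θ₀, ζ₀)).eventually_const_lt hc
  obtain ⟨ε, hε, hball⟩ := Metric.eventually_nhds_iff_ball.1 hev
  refine ⟨ball θ₀ ε, ball_mem_nhds _ hε, ε / 2, by positivity, ball ζ₀ ε, ball_mem_nhds _ hε, ?_⟩
  intro b hb hbs N
  have hbc : HasCompactSupport b := HasCompactSupport.of_support_subset_isCompact
    (isCompact_closedBall u₀ (ε / 2)) ((subset_tsupport _).trans hbs)
  let ι := {p : ℝ × E × F // 0 < p.1 ∧ p.2.1 ∈ ball θ₀ ε ∧ p.2.2 ∈ ball ζ₀ ε}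
  let Ψ : ι → E → ℝ := fun i y => inner ℝ (χ (y + i.1.1 • i.1.2.1) - χ y) i.1.2.2 / i.1.1
  let a : ι → E → ℝ := fun i y => b (y + i.1.1 • i.1.2.1) * b y
  have hχd : Differentiable ℝ χ := hχ.differentiable (by simp)
  have hshift : ∀ (v : E), ContDiff ℝ ∞ fun y : E => y + v := fun v => contDiff_id.add contDiff_const
  have hΨ : ∀ i, ContDiff ℝ ∞ (Ψ i) := fun i =>
    (((hχ.comp (hshift _)).sub hχ).inner ℝ contDiff_const).div_const _
  have hderiv : ∀ (i : ι) (x : E), fderiv ℝ (Ψ i) x e =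
      inner ℝ (G (x + i.1.1 • i.1.2.1) - G x) i.1.2.2 / i.1.1 := by
    intro i x
    exact fderiv_diffQuot hχd _ _ _ _ _
  have hs : ∀ i : ι, 0 < i.1.1 := fun i => i.2.1
  have hθ : ∀ i : ι, ‖i.1.2.1‖ ≤ ‖θ₀‖ + ε := fun i => by
    have := norm_le_norm_add_norm_sub' i.1.2.1 θ₀
    have h2 := mem_ball_iff_norm.1 i.2.2.1
    linarith
  have hζ : ∀ i : ι, ‖i.1.2.2‖ ≤ ‖ζ₀‖ + ε := fun i => by
    have := norm_le_norm_add_norm_sub' i.1.2.2 ζ₀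
    have h2 := mem_ball_iff_norm.1 i.2.2.2
    linarith
  have hΨ' : UnifSmooth e fun i x => fderiv ℝ (Ψ i) x e := by
    refine ⟨fun i => contDiff_fderiv_apply (hΨ i) e, fun k => ?_⟩
    simp only [hderiv]
    exact unifBounded_diffQuot hGs (hχc.fderiv_apply ℝ e) hs hθ hζ e k
  have hbU : ∀ v : ι → E, UnifSmooth e fun i y => b (y + v i) := by
    intro v
    refine ⟨fun i => hb.comp (hshift _), fun k => ?_⟩
    have : ∀ {g : E → ℝ}, ContDiff ℝ ∞ g → HasCompactSupport g →
        UnifBounded e k fun i y => g (y + v i) := by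
      induction k with
      | zero =>
        intro g hg hgc
        obtain ⟨C, hC⟩ := hgc.exists_bound_of_continuous hg.continuous
        exact ⟨C, fun i x => hC _⟩
      | succ k ih =>
        intro g hg hgc
        refine ⟨(ih hg hgc).exists_bound, ?_⟩
        simp only [fderiv_comp_add_right]
        exact ih (contDiff_fderiv_apply hg e) (hgc.fderiv_apply ℝ e)
    exact this hb hbc
  have ha : UnifSmooth e a := by
    have h2 := (hbU fun i => i.1.1 • i.1.2.1).mul (hbU fun _ => 0)
    simpa only [add_zero] using h2
  have haK : ∀ i, tsupport (a i) ⊆ closedBall u₀ (ε / 2) := fun i =>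
    tsupport_mul_subset_right.trans hbs
  -- The amplitude contains both `b(x)` and `b(x + sθ)`, so both endpoints, and by convexity the
  -- whole segment, lie in the small ball where the Hessian is controlled.
  have hcΨ : ∀ i, ∀ x ∈ tsupport (a i), c ≤ fderiv ℝ (Ψ i) x e := by
    intro i x hx
    have hx1 : x ∈ closedBall u₀ (ε / 2) := haK i hx
    have hx2 : x + i.1.1 • i.1.2.1 ∈ closedBall u₀ (ε / 2) := by
      have h3 : x ∈ tsupport fun y => b (y + i.1.1 • i.1.2.1) := tsupport_mul_subset_left hx
      exact hbs (tsupport_comp_subset_preimage (f := fun y => y + i.1.1 • i.1.2.1) b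
        (by fun_prop) h3)
    rw [hderiv, le_div_iff₀ (hs i)]
    let φ : ℝ → ℝ := fun t => inner ℝ (G (x + t • i.1.2.1)) i.1.2.2
    have hφ : ∀ t, HasDerivAt φ (inner ℝ (fderiv ℝ G (x + t • i.1.2.1) i.1.2.1) i.1.2.2) t := by
      intro t
      have h4 : HasDerivAt (fun t : ℝ => x + t • i.1.2.1) i.1.2.1 t := by
        simpa using ((hasDerivAt_id t).smul_const i.1.2.1).const_add x
      have h5 := (hGd (x + t • i.1.2.1)).hasFDerivAt.comp_hasDerivAt t h4
      simpa using h5.inner ℝ (hasDerivAt_const t i.1.2.2)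
    have h6 := (convex_Icc (0 : ℝ) i.1.1).mul_sub_le_image_sub_of_le_deriv (f := φ) (C := c)
      (fun t _ => (hφ t).continuousAt.continuousWithinAt)
      (fun t _ => (hφ t).differentiableAt.differentiableWithinAt) ?_ 0
      (left_mem_Icc.2 (hs i).le) i.1.1 (right_mem_Icc.2 (hs i).le) (hs i).le
    · simpa [φ, inner_sub_left] using h6
    · intro t ht
      rw [interior_Icc] at ht
      rw [(hφ t).deriv]
      have hseg : x + t • i.1.2.1 ∈ closedBall u₀ (ε / 2) := by
        have h7 := (convex_closedBall u₀ (ε / 2)).add_smul_sub_mem hx1 hx2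
          (t := t / i.1.1) ⟨div_nonneg ht.1.le (hs i).le, (div_le_one (hs i)).2 ht.2.le⟩
        rwa [add_sub_cancel_left, smul_smul, div_mul_cancel₀ _ (hs i).ne'] at h7
      refine (hball (x + t • i.1.2.1, i.1.2.1, i.1.2.2) ?_).le
      rw [← ball_prod_same, ← ball_prod_same]
      exact ⟨closedBall_subset_ball (half_lt_self hε) hseg, i.2.2.1, i.2.2.2⟩
  obtain ⟨C, hC⟩ := exists_norm_integral_osc_le (μ := (volume : Measure E)) hΨ hΨ' ha
    (isCompact_closedBall u₀ (ε / 2)) haK hc0 hcΨ N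
  exact ⟨C, fun s hs θ hθ ζ hζ τ hτ => hC ⟨(s, θ, ζ), hs, hθ, hζ⟩ τ hτ⟩

/-- Decay of the correlations when the Hessian of `χ · ζ₀` at `u₀` is nondegenerate. -/
theorem exists_norm_corr_smul_le {χ : E → F} (hχ : ContDiff ℝ ∞ χ) (hχc : HasCompactSupport χ)
    {u₀ : E} {ζ₀ : F}
    (h : ∀ θ : E, θ ≠ 0 → ∃ e, inner ℝ (fderiv ℝ (fderiv ℝ χ) u₀ θ e) ζ₀ ≠ 0) :
    ∃ r > 0, ∃ W ∈ 𝓝 ζ₀, ∀ b : E → ℝ, ContDiff ℝ ∞ b →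
      tsupport b ⊆ closedBall u₀ r → ∀ N : ℕ, ∃ C, ∀ T > 0, ∀ ζ ∈ W, ∀ w,
        ‖corr χ b ((T : ℝ)⁻¹ • w) (T • ζ)‖ ≤ C * ((1 + ‖w‖) ^ N)⁻¹ := by
  have hcomp : ∃ r > 0, ∃ W ∈ 𝓝 ζ₀, ∀ b : E → ℝ, ContDiff ℝ ∞ b →
      tsupport b ⊆ closedBall u₀ r → ∀ N : ℕ, ∃ C, ∀ s > 0, ∀ θ ∈ sphere (0 : E) 1, ∀ ζ ∈ W,
        ∀ τ > 0, ‖∫ y, osc (τ * (inner ℝ (χ (y + s • θ) - χ y) ζ / s)) *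
          ((b (y + s • θ) * b y : ℝ) : ℂ)‖ ≤ C * (τ ^ N)⁻¹ := by
    refine (isCompact_sphere (0 : E) 1).induction_on
      (p := fun V => ∃ r > 0, ∃ W ∈ 𝓝 ζ₀, ∀ b : E → ℝ, ContDiff ℝ ∞ b →
      tsupport b ⊆ closedBall u₀ r → ∀ N : ℕ, ∃ C, ∀ s > 0, ∀ θ ∈ V, ∀ ζ ∈ W,
        ∀ τ > 0, ‖∫ y, osc (τ * (inner ℝ (χ (y + s • θ) - χ y) ζ / s)) *
          ((b (y + s • θ) * b y : ℝ) : ℂ)‖ ≤ C * (τ ^ N)⁻¹) ?_ ?_ ?_ ?_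
    · exact ⟨1, one_pos, univ, univ_mem, fun b _ _ N => ⟨0, by simp⟩⟩
    · rintro V V' hVV ⟨r, hr, W, hW, H⟩
      refine ⟨r, hr, W, hW, fun b hb hbs N => ?_⟩
      obtain ⟨C, hC⟩ := H b hb hbs N
      exact ⟨C, fun s hs θ hθ => hC s hs θ (hVV hθ)⟩
    · rintro V V' ⟨r, hr, W, hW, H⟩ ⟨r', hr', W', hW', H'⟩
      refine ⟨min r r', lt_min hr hr', W ∩ W', inter_mem hW hW', fun b hb hbs N => ?_⟩
      obtain ⟨C, hC⟩ := H b hb (hbs.trans (closedBall_subset_closedBall (min_le_left _ _))) N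
      obtain ⟨C', hC'⟩ := H' b hb (hbs.trans (closedBall_subset_closedBall (min_le_right _ _))) N
      refine ⟨max C C', fun s hs θ hθ ζ hζ τ hτ => ?_⟩
      rcases hθ with hθ | hθ
      · exact (hC s hs θ hθ ζ hζ.1 τ hτ).trans (by gcongr; exact le_max_left _ _)
      · exact (hC' s hs θ hθ ζ hζ.2 τ hτ).trans (by gcongr; exact le_max_right _ _)
    · intro θ hθ
      have hθ0 : θ ≠ 0 := ne_zero_of_mem_unit_sphere (⟨θ, hθ⟩ : sphere (0 : E) 1)
      obtain ⟨e, he⟩ : ∃ e, 0 < inner ℝ (fderiv ℝ (fderiv ℝ χ) u₀ θ e) ζ₀ := by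
        obtain ⟨e, he⟩ := h θ hθ0
        rcases lt_or_gt_of_ne he with he | he
        · exact ⟨-e, by simpa using he⟩
        · exact ⟨e, he⟩
      have heq : fderiv ℝ (fun y => fderiv ℝ χ y e) u₀ θ = fderiv ℝ (fderiv ℝ χ) u₀ θ e := by
        rw [fderiv_clm_apply ((hχ.fderiv_right (m := ∞) (by simp)).differentiable (by simp) u₀)
          (differentiableAt_const e)]
        simp
      obtain ⟨V, hV, H⟩ := exists_norm_corr_le_near hχ hχc (heq ▸ he)
      exact ⟨V, mem_nhdsWithin_of_mem_nhds hV, H⟩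
  obtain ⟨r, hr, W, hW, H⟩ := hcomp
  refine ⟨r, hr, W, hW, fun b hb hbs N => ?_⟩
  obtain ⟨C, hC⟩ := H b hb hbs N
  have hbc : HasCompactSupport b := HasCompactSupport.of_support_subset_isCompact
    (isCompact_closedBall u₀ r) ((subset_tsupport _).trans hbs)
  obtain ⟨D, hD⟩ := exists_norm_corr_le (χ := χ) hb.continuous hbc
  -- For `|w| ≥ 1` take `s = |w|/T`, `θ = w/|w|`, `τ = |w|`; for `|w| < 1` use the trivial bound
  -- `D`. The factor `2^N` comes from `1 + |w| ≤ 2 max(1, |w|)`.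
  refine ⟨max |C| D * 2 ^ N, fun T hT ζ hζ w => ?_⟩
  have hM : 0 ≤ max |C| D := (abs_nonneg C).trans (le_max_left _ _)
  rcases le_or_gt 1 ‖w‖ with hw | hw
  · have hw0 : 0 < ‖w‖ := by linarith
    have hTw : (‖w‖ / T) • (‖w‖⁻¹ • w) = T⁻¹ • w := by
      rw [smul_smul]
      congr 1
      field_simp
    have h1 := hC (‖w‖ / T) (by positivity) (‖w‖⁻¹ • w)
      (by rw [mem_sphere_zero_iff_norm, norm_smul, norm_inv, norm_norm, inv_mul_cancel₀ hw0.ne'])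
      ζ hζ ‖w‖ hw0
    have h2 : ‖corr χ b (T⁻¹ • w) (T • ζ)‖ ≤ C * (‖w‖ ^ N)⁻¹ := by
      refine le_trans (le_of_eq ?_) h1
      rw [corr, hTw]
      congr 3
      ext y
      congr 2
      rw [inner_smul_right]
      field_simp
    calc _ ≤ _ := h2
      _ ≤ max |C| D * (‖w‖ ^ N)⁻¹ := by
        gcongr
        exact (le_abs_self C).trans (le_max_left _ _)
      _ ≤ max |C| D * (2 ^ N * ((1 + ‖w‖) ^ N)⁻¹) := by
        gcongr
        rw [← div_eq_mul_inv, inv_le_iff_one_le_mul₀ (by positivity), div_mul_eq_mul_div,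
          le_div_iff₀ (by positivity), one_mul, ← mul_pow]
        gcongr
        linarith
      _ = _ := by ring
  · calc _ ≤ D := hD _ _
      _ ≤ max |C| D * 1 := by rw [mul_one]; exact le_max_right _ _
      _ ≤ max |C| D * (2 ^ N * ((1 + ‖w‖) ^ N)⁻¹) := by
        gcongr
        rw [← div_eq_mul_inv, le_div_iff₀ (by positivity), one_mul]
        gcongr
        linarith
      _ = _ := by ring

theorem integrable_inv_one_add_norm_pow :
    Integrable fun w : E => ((1 + ‖w‖) ^ (Module.finrank ℝ E + 1))⁻¹ := by
  have := integrable_one_add_norm (E := E) (μ := volume) (r := (Module.finrank ℝ E + 1 : ℕ))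
    (by push_cast; linarith)
  refine this.congr (ae_of_all _ fun w => ?_)
  simp only
  rw [Real.rpow_neg (by positivity), Real.rpow_natCast]

/-- The oscillatory integral decays like `T^{-n/2}` in directions where the Hessian of the phase is
nondegenerate. -/
theorem exists_oscInt_le_of_nondegenerate {χ : E → F} (hχ : ContDiff ℝ ∞ χ)
    (hχc : HasCompactSupport χ) {u₀ : E} {ζ₀ : F}
    (h : ∀ θ : E, θ ≠ 0 → ∃ e, inner ℝ (fderiv ℝ (fderiv ℝ χ) u₀ θ e) ζ₀ ≠ 0) :
    ∃ r > 0, ∃ W ∈ 𝓝 ζ₀, ∀ b : E → ℝ, ContDiff ℝ ∞ b →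
      tsupport b ⊆ closedBall u₀ r → ∃ C, ∀ T ≥ 1, ∀ ζ ∈ W,
        (T : ℝ) ^ Module.finrank ℝ E * ‖oscInt χ b (T • ζ)‖ ^ 2 ≤ C := by
  obtain ⟨r, hr, W, hW, H⟩ := exists_norm_corr_smul_le hχ hχc h
  refine ⟨r, hr, W, hW, fun b hb hbs => ?_⟩
  -- One power more than the dimension makes the majorant integrable in `w`.
  obtain ⟨C, hC⟩ := H b hb hbs (Module.finrank ℝ E + 1)
  have hbc : HasCompactSupport b := HasCompactSupport.of_support_subset_isCompact
    (isCompact_closedBall u₀ r) ((subset_tsupport _).trans hbs)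
  refine ⟨∫ w : E, C * ((1 + ‖w‖) ^ (Module.finrank ℝ E + 1))⁻¹, fun T hT ζ hζ => ?_⟩
  have hT0 : 0 < T := by linarith
  have h1 := norm_integral_le_of_norm_le (integrable_inv_one_add_norm_pow.const_mul C)
    (ae_of_all _ (hC T hT0 ζ hζ))
  rw [← norm_sq_oscInt_smul hχ.continuous hb.continuous hbc hT0, Complex.norm_real] at h1
  exact (le_abs_self _).trans h1

/-- The oscillatory integral decays rapidly in directions where the phase is nonstationary. -/
theorem exists_oscInt_le_of_nonstationary {χ : E → F} (hχ : ContDiff ℝ ∞ χ)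
    (hχc : HasCompactSupport χ) {u₀ e : E} {ζ₀ : F} (h : inner ℝ (fderiv ℝ χ u₀ e) ζ₀ ≠ 0) :
    ∃ r > 0, ∃ W ∈ 𝓝 ζ₀, ∀ b : E → ℝ, ContDiff ℝ ∞ b →
      tsupport b ⊆ closedBall u₀ r → ∃ C, ∀ T ≥ 1, ∀ ζ ∈ W,
        (T : ℝ) ^ Module.finrank ℝ E * ‖oscInt χ b (T • ζ)‖ ^ 2 ≤ C := by
  wlog h' : 0 < inner ℝ (fderiv ℝ χ u₀ e) ζ₀ generalizing e
  · refine this (e := -e) (by simpa using h) ?_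
    simpa using lt_of_le_of_ne (not_lt.1 h') h
  have hχd : Differentiable ℝ χ := hχ.differentiable (by simp)
  have hcont : Continuous fun p : E × F => inner ℝ (fderiv ℝ χ p.1 e) p.2 :=
    (((hχ.continuous_fderiv (by simp)).comp continuous_fst).clm_apply
      continuous_const).inner continuous_snd
  obtain ⟨c, hc0, hc⟩ := exists_between h'
  have hev := (hcont.tendsto (u₀, ζ₀)).eventually_const_lt hc
  obtain ⟨ε, hε, hball⟩ := Metric.eventually_nhds_iff_ball.1 hev
  refine ⟨ε / 2, by positivity, ball ζ₀ ε, ball_mem_nhds _ hε, fun b hb hbs => ?_⟩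
  have hζ : ∀ i : ball ζ₀ ε, ‖(i : F)‖ ≤ ‖ζ₀‖ + ε := fun i => by
    have := norm_le_norm_add_norm_sub' (i : F) ζ₀
    have h2 := mem_ball_iff_norm.1 i.2
    linarith
  have hbc : HasCompactSupport b := HasCompactSupport.of_support_subset_isCompact
    (isCompact_closedBall u₀ (ε / 2)) ((subset_tsupport _).trans hbs)
  have hΨ : ∀ i : ball ζ₀ ε, ContDiff ℝ ∞ fun y => (inner ℝ (χ y) (i : F) : ℝ) := fun i =>
    hχ.inner ℝ contDiff_const
  have hΨ' : UnifSmooth e fun (i : ball ζ₀ ε) x => fderiv ℝ (fun y => inner ℝ (χ y) (i : F)) x e := by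
    refine ⟨fun i => contDiff_fderiv_apply (hΨ i) e, fun k => ?_⟩
    simp only [fderiv_inner_const hχd]
    exact unifBounded_inner (contDiff_fderiv_apply hχ e) (hχc.fderiv_apply ℝ e) hζ e k
  have ha : UnifSmooth e fun (_ : ball ζ₀ ε) y => b y := by
    refine ⟨fun _ => hb, fun k => ?_⟩
    -- On `ℝ` the inner product with `1` is the identity, so the bound for inner products covers a
    -- fixed amplitude.
    simpa using unifBounded_inner hb hbc (ζ := fun _ : ball ζ₀ ε => (1 : ℝ)) (B := 1)
      (by simp) e k
  obtain ⟨C, hC⟩ := exists_norm_integral_osc_le (μ := (volume : Measure E)) hΨ hΨ' ha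
    (isCompact_closedBall u₀ (ε / 2)) (fun _ => hbs) hc0 (fun i x hx => by
      rw [fderiv_inner_const hχd]
      refine (hball (x, (i : F)) ?_).le
      rw [← ball_prod_same]
      exact ⟨closedBall_subset_ball (half_lt_self hε) (hbs hx), i.2⟩) (Module.finrank ℝ E)
  refine ⟨C ^ 2, fun T hT ζ hζ => ?_⟩
  have hT0 : 0 < T := by linarith
  have h1 : ‖oscInt χ b (T • ζ)‖ ≤ C * (T ^ Module.finrank ℝ E)⁻¹ := by
    simpa only [oscInt, inner_smul_right] using hC ⟨ζ, hζ⟩ T hT0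
  have hTn : 1 ≤ T ^ Module.finrank ℝ E := one_le_pow₀ hT
  calc _ ≤ T ^ Module.finrank ℝ E * (C * (T ^ Module.finrank ℝ E)⁻¹) ^ 2 := by gcongr
    _ = C ^ 2 * (T ^ Module.finrank ℝ E)⁻¹ := by field_simp
    _ ≤ C ^ 2 * 1 := by gcongr; exact inv_le_one_of_one_le₀ hTn
    _ = C ^ 2 := mul_one _

end OscillatoryIntegrals

/-! ### Lipschitz bounds and the gradient of the phase -/

theorem continuous_osc_fderiv {E F : Type*} [NormedAddCommGroup E] [NormedSpace ℝ E]
    [NormedAddCommGroup F] [InnerProductSpace ℝ F] {χ : E → F} (hχ : ContDiff ℝ ∞ χ) (ζ : F) :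
    Continuous fun p : E × E => osc (inner ℝ (fderiv ℝ χ p.2 p.1) ζ) :=
  continuous_osc.comp ((((hχ.continuous_fderiv (by simp)).comp continuous_snd).clm_apply
    continuous_fst).inner continuous_const)

theorem exists_lipschitz_bound {E G : Type*} [NormedAddCommGroup E] [NormedSpace ℝ E]
    [NormedAddCommGroup G] [NormedSpace ℝ G] {g : E → G} (hg : ContDiff ℝ ∞ g)
    (hgc : HasCompactSupport g) : ∃ K, 0 ≤ K ∧ ∀ x y, ‖g x - g y‖ ≤ K * ‖x - y‖ := by
  obtain ⟨K, hK⟩ := (hgc.fderiv ℝ).exists_bound_of_continuous (hg.continuous_fderiv (by simp))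
  exact ⟨K, (norm_nonneg _).trans (hK 0), fun x y =>
    convex_univ.norm_image_sub_le_of_norm_fderiv_le
      (fun y _ => hg.differentiable (by simp) y) (fun y _ => hK y) (mem_univ _) (mem_univ _)⟩

section Gradient

variable {E F : Type*} [NormedAddCommGroup E] [InnerProductSpace ℝ E] [CompleteSpace E]
  [NormedAddCommGroup F] [InnerProductSpace ℝ F] [CompleteSpace F]

/-- The gradient of `χ · ζ`. -/
noncomputable def gradInner (χ : E → F) (ζ : F) (y : E) : E :=
  ContinuousLinearMap.adjoint (fderiv ℝ χ y) ζ

theorem inner_fderiv_eq (χ : E → F) (ζ : F) (y w : E) :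
    inner ℝ (fderiv ℝ χ y w) ζ = inner ℝ (gradInner χ ζ y) w := by
  rw [gradInner, ContinuousLinearMap.adjoint_inner_left, real_inner_comm]

theorem continuous_gradInner {χ : E → F} (hχ : ContDiff ℝ ∞ χ) (ζ : F) :
    Continuous (gradInner χ ζ) := by
  have h1 : Continuous fun y => ContinuousLinearMap.adjoint (fderiv ℝ χ y) :=
    ContinuousLinearMap.adjoint.continuous.comp (hχ.continuous_fderiv (by simp))
  exact h1.clm_apply continuous_const

/-- The gradient vanishes at `u₀`, and compact support makes the derivative of `χ` globally
Lipschitz. -/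
theorem exists_norm_gradInner_le {χ : E → F} (hχ : ContDiff ℝ ∞ χ) (hχc : HasCompactSupport χ)
    {u₀ : E} {ζ : F} (hn : ∀ e, inner ℝ (fderiv ℝ χ u₀ e) ζ = 0) :
    ∃ K, 0 ≤ K ∧ ∀ y, ‖gradInner χ ζ y‖ ≤ K * ‖y - u₀‖ := by
  obtain ⟨K, hK0, hK⟩ := exists_lipschitz_bound (hχ.fderiv_right (m := ∞) (by simp)) (hχc.fderiv ℝ)
  refine ⟨K * ‖ζ‖, mul_nonneg hK0 (norm_nonneg _), fun y => ?_⟩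
  have h1 := hK y u₀
  have h2 : ‖gradInner χ ζ y‖ * ‖gradInner χ ζ y‖ ≤
      K * ‖ζ‖ * ‖y - u₀‖ * ‖gradInner χ ζ y‖ := by
    set v := gradInner χ ζ y with hv
    calc ‖v‖ * ‖v‖ = inner ℝ ((fderiv ℝ χ y - fderiv ℝ χ u₀) v) ζ := by
          rw [sub_apply, inner_sub_left, hn, sub_zero, inner_fderiv_eq, ← hv,
            real_inner_self_eq_norm_mul_norm]
      _ ≤ ‖(fderiv ℝ χ y - fderiv ℝ χ u₀) v‖ * ‖ζ‖ := real_inner_le_norm _ _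
      _ ≤ (K * ‖y - u₀‖ * ‖v‖) * ‖ζ‖ := by
        gcongr
        exact (ContinuousLinearMap.le_opNorm _ _).trans (by gcongr)
      _ = _ := by ring
  rcases (norm_nonneg (gradInner χ ζ y)).eq_or_lt with h3 | h3
  · rw [← h3]
    exact mul_nonneg (mul_nonneg hK0 (norm_nonneg _)) (norm_nonneg _)
  · exact le_of_mul_le_mul_right h2 h3

end Gradient

/-! ### The stationary phase lower bound -/

section StationaryPhase

variable {E F : Type*} [NormedAddCommGroup E] [InnerProductSpace ℝ E] [FiniteDimensional ℝ E]
  [NormedAddCommGroup F] [InnerProductSpace ℝ F] [MeasurableSpace E] [BorelSpace E]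

/-- The rescaled limit of the correlations `corr`. -/
noncomputable def corrLimit (χ : E → F) (b : E → ℝ) (ζ : F) (w : E) : ℂ :=
  ∫ y, osc (inner ℝ (fderiv ℝ χ y w) ζ) * ((b y * b y : ℝ) : ℂ)

/-- The rescaled phase `T (χ(y + w/T) - χ(y)) · ζ` is a difference quotient tending to `dχ(w) · ζ₀`.
The limit is taken jointly in `T` and `ζ`, so the final bound holds on a neighbourhood of
directions. -/
theorem tendsto_corr {χ : E → F} (hχ : ContDiff ℝ ∞ χ) {b : E → ℝ} (hb : Continuous b)
    (hbc : HasCompactSupport b) (ζ₀ : F) (w : E) :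
    Tendsto (fun p : ℝ × F => corr χ b (p.1⁻¹ • w) (p.1 • p.2)) (atTop ×ˢ 𝓝 ζ₀)
      (𝓝 (corrLimit χ b ζ₀ w)) := by
  obtain ⟨C, hC⟩ := hbc.exists_bound_of_continuous hb
  refine tendsto_integral_filter_of_dominated_convergence (fun y => C * ‖b y‖) ?_ ?_ ?_ ?_
  · refine Eventually.of_forall fun p => Continuous.aestronglyMeasurable ?_
    have h1 : Continuous fun y : E => y + p.1⁻¹ • w := by fun_prop
    exact (continuous_osc.comp (((hχ.continuous.comp h1).sub hχ.continuous).inner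
      continuous_const)).mul (Complex.continuous_ofReal.comp ((hb.comp h1).mul hb))
  · refine Eventually.of_forall fun p => ae_of_all _ fun y => ?_
    rw [norm_mul, norm_osc, one_mul, Complex.norm_real, norm_mul]
    exact mul_le_mul_of_nonneg_right (hC _) (norm_nonneg _)
  · exact (hb.integrable_of_hasCompactSupport hbc).norm.const_mul C
  · refine ae_of_all _ fun y => ?_
    have hfst : Tendsto (fun p : ℝ × F => p.1) (atTop ×ˢ 𝓝 ζ₀) atTop := tendsto_fst
    have h1 : Tendsto (fun p : ℝ × F => y + p.1⁻¹ • w) (atTop ×ˢ 𝓝 ζ₀) (𝓝 y) := by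
      simpa using ((tendsto_inv_atTop_zero.comp hfst).smul_const w).const_add y
    have h2 : Tendsto (fun p : ℝ × F => inner ℝ (χ (y + p.1⁻¹ • w) - χ y) (p.1 • p.2))
        (atTop ×ˢ 𝓝 ζ₀) (𝓝 (inner ℝ (fderiv ℝ χ y w) ζ₀)) := by
      have h3 := ((hχ.differentiable (by simp) y).hasFDerivAt.lim_real w).comp hfst
      refine (h3.inner (tendsto_snd (f := atTop) (g := 𝓝 ζ₀))).congr fun p => ?_
      simp [inner_smul_left, inner_smul_right]
    refine ((continuous_osc.tendsto _).comp h2).mul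
      ((Complex.continuous_ofReal.tendsto _).comp ?_)
    exact ((hb.tendsto y).comp h1).mul_const (b y)

theorem stronglyMeasurable_corr {χ : E → F} (hχ : Continuous χ) {b : E → ℝ} (hb : Continuous b)
    (T : ℝ) (ζ : F) : StronglyMeasurable fun w => corr χ b (T • w) ζ := by
  have h1 : Continuous fun p : E × E => p.2 + T • p.1 := by fun_prop
  have h : Continuous fun p : E × E =>
      osc (inner ℝ (χ (p.2 + T • p.1) - χ p.2) ζ) * ((b (p.2 + T • p.1) * b p.2 : ℝ) : ℂ) :=
    (continuous_osc.comp (((hχ.comp h1).sub (hχ.comp continuous_snd)).inner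
      continuous_const)).mul (Complex.continuous_ofReal.comp
        ((hb.comp h1).mul (hb.comp continuous_snd)))
  exact h.stronglyMeasurable.integral_prod_right

theorem stronglyMeasurable_corrLimit {χ : E → F} (hχ : ContDiff ℝ ∞ χ) {b : E → ℝ}
    (hb : Continuous b) (ζ : F) : StronglyMeasurable (corrLimit χ b ζ) := by
  have h : Continuous fun p : E × E =>
      osc (inner ℝ (fderiv ℝ χ p.2 p.1) ζ) * ((b p.2 * b p.2 : ℝ) : ℂ) :=
    (continuous_osc_fderiv hχ ζ).mul (Complex.continuous_ofReal.comp
        ((hb.comp continuous_snd).mul (hb.comp continuous_snd)))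
  exact h.stronglyMeasurable.integral_prod_right

theorem integral_osc_mul_gaussian {ε : ℝ} (hε : 0 < ε) (z : E) :
    ∫ w : E, osc (inner ℝ z w) * (Real.exp (-(Real.pi * ε ^ 2) * ‖w‖ ^ 2) : ℂ) =
      (((ε ^ Module.finrank ℝ E)⁻¹ * Real.exp (-Real.pi * (‖z‖ / ε) ^ 2) : ℝ) : ℂ) := by
  have hpi := Real.pi_pos
  have h := GaussianFourier.integral_cexp_neg_mul_sq_norm_add (V := E)
    (b := ((Real.pi * ε ^ 2 : ℝ) : ℂ)) (by rw [Complex.ofReal_re]; positivity)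
    (-(2 * Real.pi) * Complex.I) z
  have h1 : ∀ w : E, osc (inner ℝ z w) * (Real.exp (-(Real.pi * ε ^ 2) * ‖w‖ ^ 2) : ℂ) =
      Complex.exp (-((Real.pi * ε ^ 2 : ℝ) : ℂ) * ‖w‖ ^ 2 +
        -(2 * Real.pi) * Complex.I * (inner ℝ z w : ℝ)) := by
    intro w
    rw [osc, Complex.ofReal_exp, ← Complex.exp_add]
    congr 1
    push_cast
    ring
  simp_rw [h1]
  rw [h]
  have h2 : ((Real.pi : ℂ) / ((Real.pi * ε ^ 2 : ℝ) : ℂ)) ^ (Module.finrank ℝ E / 2 : ℂ) =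
      (((ε ^ Module.finrank ℝ E)⁻¹ : ℝ) : ℂ) := by
    rw [← Complex.ofReal_div, show (Module.finrank ℝ E / 2 : ℂ) =
      ((Module.finrank ℝ E / 2 : ℝ) : ℂ) by push_cast; rfl, ← Complex.ofReal_cpow (by positivity)]
    congr 1
    rw [show Real.pi / (Real.pi * ε ^ 2) = (ε⁻¹) ^ 2 by field_simp, ← Real.rpow_natCast,
      ← Real.rpow_mul (by positivity), ← inv_pow, ← Real.rpow_natCast]
    congr 1
    push_cast
    ring
  rw [h2, Complex.ofReal_mul (ε ^ _)⁻¹, Complex.ofReal_exp]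
  congr 2
  have hε' : (ε : ℂ) ≠ 0 := by exact_mod_cast hε.ne'
  have hpi' : (Real.pi : ℂ) ≠ 0 := by exact_mod_cast hpi.ne'
  push_cast
  field_simp
  rw [Complex.I_sq]
  ring

variable [CompleteSpace F]

/-- The Gaussian makes the double integral absolutely convergent, so Fubini applies, and its Fourier
transform is evaluated at the gradient of the phase. The result has a nonnegative integrand,
concentrated where the gradient is small. -/
theorem integral_corrLimit_mul_gaussian {χ : E → F} (hχ : ContDiff ℝ ∞ χ) (ζ : F)
    {b : E → ℝ} (hb : Continuous b) (hbc : HasCompactSupport b) {ε : ℝ} (hε : 0 < ε) :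
    ∫ w, corrLimit χ b ζ w * (Real.exp (-(Real.pi * ε ^ 2) * ‖w‖ ^ 2) : ℂ) =
      ((∫ y, b y * b y * ((ε ^ Module.finrank ℝ E)⁻¹ *
        Real.exp (-Real.pi * (‖gradInner χ ζ y‖ / ε) ^ 2)) : ℝ) : ℂ) := by
  have hpi := Real.pi_pos
  have hbb : Integrable fun y => b y * b y :=
    (hb.mul hb).integrable_of_hasCompactSupport hbc.mul_left
  have hγ : Integrable fun w : E => Real.exp (-(Real.pi * ε ^ 2) * ‖w‖ ^ 2) := by
    have h := GaussianFourier.integrable_cexp_neg_mul_sq_norm_add (V := E)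
      (b := ((Real.pi * ε ^ 2 : ℝ) : ℂ)) (by rw [Complex.ofReal_re]; positivity) 0 0
    refine h.norm.congr (ae_of_all _ fun w => ?_)
    simp only [zero_mul, add_zero]
    rw [show -((Real.pi * ε ^ 2 : ℝ) : ℂ) * (‖w‖ : ℂ) ^ 2 =
      ((-(Real.pi * ε ^ 2) * ‖w‖ ^ 2 : ℝ) : ℂ) by push_cast; ring, ← Complex.ofReal_exp,
      Complex.norm_real, Real.norm_of_nonneg (Real.exp_nonneg _)]
  have hint : Integrable (fun p : E × E => osc (inner ℝ (fderiv ℝ χ p.2 p.1) ζ) *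
      ((b p.2 * b p.2 : ℝ) : ℂ) * (Real.exp (-(Real.pi * ε ^ 2) * ‖p.1‖ ^ 2) : ℂ))
      ((volume : Measure E).prod volume) := by
    refine (hγ.mul_prod hbb).mono' ?_ (ae_of_all _ fun p => ?_)
    · refine Continuous.aestronglyMeasurable (((continuous_osc_fderiv hχ ζ).mul
        (Complex.continuous_ofReal.comp ((hb.comp continuous_snd).mul
          (hb.comp continuous_snd)))).mul (Complex.continuous_ofReal.comp (by fun_prop)))
    · rw [norm_mul, norm_mul, norm_osc, one_mul, Complex.norm_real, Complex.norm_real,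
        Real.norm_of_nonneg (mul_self_nonneg _), Real.norm_of_nonneg (Real.exp_nonneg _),
        mul_comm]
  calc _ = ∫ w, ∫ y, osc (inner ℝ (fderiv ℝ χ y w) ζ) * ((b y * b y : ℝ) : ℂ) *
        (Real.exp (-(Real.pi * ε ^ 2) * ‖w‖ ^ 2) : ℂ) := by
        simp_rw [integral_mul_const]
        rfl
    _ = ∫ y, ∫ w, osc (inner ℝ (fderiv ℝ χ y w) ζ) * ((b y * b y : ℝ) : ℂ) *
        (Real.exp (-(Real.pi * ε ^ 2) * ‖w‖ ^ 2) : ℂ) := integral_integral_swap hint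
    _ = ∫ y, ((b y * b y * ((ε ^ Module.finrank ℝ E)⁻¹ *
        Real.exp (-Real.pi * (‖gradInner χ ζ y‖ / ε) ^ 2)) : ℝ) : ℂ) := by
        congr 1
        ext y
        rw [Complex.ofReal_mul (b y * b y), ← integral_osc_mul_gaussian hε, ← integral_const_mul]
        congr 1
        ext w
        rw [inner_fderiv_eq]
        ring
    _ = _ := integral_ofReal

/-- Lower bound for the Gaussian regularisation of `∫ corrLimit`. -/
theorem exists_le_integral_corrLimit_mul_gaussian {χ : E → F} (hχ : ContDiff ℝ ∞ χ)
    (hχc : HasCompactSupport χ) {u₀ : E} {ζ₀ : F} (hn : ∀ e, inner ℝ (fderiv ℝ χ u₀ e) ζ₀ = 0)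
    {b : E → ℝ} (hb : Continuous b) (hbc : HasCompactSupport b) (hb0 : b u₀ ≠ 0) :
    ∃ c > 0, ∀ᶠ ε in 𝓝[>] (0 : ℝ), c ≤
      (∫ w, corrLimit χ b ζ₀ w * (Real.exp (-(Real.pi * ε ^ 2) * ‖w‖ ^ 2) : ℂ)).re := by
  set n := Module.finrank ℝ E with hn'
  obtain ⟨K, hK0, hK⟩ := exists_norm_gradInner_le hχ hχc hn
  have hΦc := continuous_gradInner hχ ζ₀
  set Φ := gradInner χ ζ₀ with hΦ
  have hpi := Real.pi_pos
  have hVpos : 0 < (volume : Measure E).real (ball 0 1) :=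
    ENNReal.toReal_pos (measure_ball_pos _ _ one_pos).ne' measure_ball_lt_top.ne
  obtain ⟨B, hB⟩ : ∃ B, B = b u₀ * b u₀ := ⟨_, rfl⟩
  have hB0 : 0 < B := hB ▸ mul_self_pos.2 hb0
  -- On the ball of radius `ε` about `u₀` the gradient is at most `Kε` and `b² ≥ B/2`; the volume
  -- `εⁿ |B₁|` of this ball cancels the factor `ε⁻ⁿ`.
  refine ⟨B / 2 * Real.exp (-Real.pi * K ^ 2) * (volume : Measure E).real (ball 0 1),
    by positivity, ?_⟩
  obtain ⟨δ, hδ, hball⟩ := Metric.eventually_nhds_iff_ball.1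
    (((hb.mul hb).tendsto u₀).eventually_const_lt (show B / 2 < b u₀ * b u₀ by linarith))
  filter_upwards [Ioo_mem_nhdsGT hδ] with ε hε
  have hε0 : 0 < ε := hε.1
  rw [integral_corrLimit_mul_gaussian hχ ζ₀ hb hbc hε0, Complex.ofReal_re, ← hΦ, ← hn']
  have hGint : Integrable fun y => b y * b y * ((ε ^ n)⁻¹ *
      Real.exp (-Real.pi * (‖Φ y‖ / ε) ^ 2)) :=
    ((hb.mul hb).mul (continuous_const.mul (Real.continuous_exp.comp (continuous_const.mul
      ((hΦc.norm.div_const ε).pow 2))))).integrable_of_hasCompactSupport hbc.mul_left.mul_right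
  have hGnn : ∀ y, 0 ≤ b y * b y * ((ε ^ n)⁻¹ * Real.exp (-Real.pi * (‖Φ y‖ / ε) ^ 2)) := fun y =>
    mul_nonneg (mul_self_nonneg _) (by positivity)
  have hmono : ∀ y ∈ closedBall u₀ ε, B / 2 * ((ε ^ n)⁻¹ * Real.exp (-Real.pi * K ^ 2)) ≤
      b y * b y * ((ε ^ n)⁻¹ * Real.exp (-Real.pi * (‖Φ y‖ / ε) ^ 2)) := by
    intro y hy
    have hyε : ‖y - u₀‖ ≤ ε := by rwa [← dist_eq_norm]
    have h1 : B / 2 ≤ b y * b y := (hball y (lt_of_le_of_lt hy hε.2)).le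
    have h2 : ‖Φ y‖ / ε ≤ K := by
      rw [div_le_iff₀ hε0]
      exact (hK y).trans (by gcongr)
    have h3 : Real.exp (-Real.pi * K ^ 2) ≤ Real.exp (-Real.pi * (‖Φ y‖ / ε) ^ 2) := by
      rw [Real.exp_le_exp, neg_mul, neg_mul, neg_le_neg_iff]
      gcongr
    exact mul_le_mul h1 (by gcongr) (by positivity) (mul_self_nonneg _)
  calc _ = ∫ y in closedBall u₀ ε, B / 2 * ((ε ^ n)⁻¹ * Real.exp (-Real.pi * K ^ 2)) := by
        rw [setIntegral_const, Measure.addHaar_real_closedBall _ _ hε0.le, smul_eq_mul, ← hn']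
        have : ε ^ n ≠ 0 := by positivity
        field_simp
    _ ≤ ∫ y in closedBall u₀ ε, b y * b y * ((ε ^ n)⁻¹ *
          Real.exp (-Real.pi * (‖Φ y‖ / ε) ^ 2)) :=
        setIntegral_mono_on (integrableOn_const (isCompact_closedBall _ _).measure_lt_top.ne)
          hGint.integrableOn measurableSet_closedBall hmono
    _ ≤ _ := setIntegral_le_integral hGint (ae_of_all _ hGnn)

/-- Lower bound of stationary phase: at a nondegenerate critical point the oscillatory integral is
at least of the order `T^{-n/2}`. -/
theorem exists_le_oscInt {χ : E → F} (hχ : ContDiff ℝ ∞ χ)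
    (hχc : HasCompactSupport χ) {u₀ : E} {ζ₀ : F} (hn : ∀ e, inner ℝ (fderiv ℝ χ u₀ e) ζ₀ = 0)
    (h : ∀ θ : E, θ ≠ 0 → ∃ e, inner ℝ (fderiv ℝ (fderiv ℝ χ) u₀ θ e) ζ₀ ≠ 0) :
    ∃ r > 0, ∀ b : E → ℝ, ContDiff ℝ ∞ b → tsupport b ⊆ closedBall u₀ r → b u₀ ≠ 0 →
      ∃ c > 0, ∀ᶠ p in (atTop : Filter ℝ) ×ˢ 𝓝 ζ₀,
        c ≤ p.1 ^ Module.finrank ℝ E * ‖oscInt χ b (p.1 • p.2)‖ ^ 2 := by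
  obtain ⟨r, hr, W, hW, H⟩ := exists_norm_corr_smul_le hχ hχc h
  refine ⟨r, hr, fun b hb hbs hb0 => ?_⟩
  have hbc : HasCompactSupport b := HasCompactSupport.of_support_subset_isCompact
    (isCompact_closedBall u₀ r) ((subset_tsupport _).trans hbs)
  obtain ⟨C, hC⟩ := H b hb hbs (Module.finrank ℝ E + 1)
  have hev : ∀ᶠ p : ℝ × F in atTop ×ˢ 𝓝 ζ₀, 0 < p.1 ∧ p.2 ∈ W :=
    (eventually_gt_atTop 0).prod_mk hW
  -- The limit inherits the decay of the correlations. The same majorant then serves both limits, `T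
  -- → ∞` and removal of the Gaussian as `ε → 0`.
  have hJ : ∀ w, ‖corrLimit χ b ζ₀ w‖ ≤ C * ((1 + ‖w‖) ^ (Module.finrank ℝ E + 1))⁻¹ := fun w =>
    le_of_tendsto (tendsto_corr hχ hb.continuous hbc ζ₀ w).norm
      (hev.mono fun p hp => hC p.1 hp.1 p.2 hp.2 w)
  have hint := (integrable_inv_one_add_norm_pow (E := E)).const_mul C
  have hlim : Tendsto (fun p : ℝ × F => ∫ w, corr χ b (p.1⁻¹ • w) (p.1 • p.2)) (atTop ×ˢ 𝓝 ζ₀)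
      (𝓝 (∫ w, corrLimit χ b ζ₀ w)) :=
    tendsto_integral_filter_of_dominated_convergence _
      (Eventually.of_forall fun p =>
        (stronglyMeasurable_corr hχ.continuous hb.continuous _ _).aestronglyMeasurable)
      (hev.mono fun p hp => ae_of_all _ (hC p.1 hp.1 p.2 hp.2)) hint
      (ae_of_all _ fun w => tendsto_corr hχ hb.continuous hbc ζ₀ w)
  have hlim2 : Tendsto (fun ε : ℝ => ∫ w, corrLimit χ b ζ₀ w *
      (Real.exp (-(Real.pi * ε ^ 2) * ‖w‖ ^ 2) : ℂ)) (𝓝[>] 0) (𝓝 (∫ w, corrLimit χ b ζ₀ w)) := by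
    refine tendsto_integral_filter_of_dominated_convergence _ (Eventually.of_forall fun ε => ?_)
      (Eventually.of_forall fun ε => ae_of_all _ fun w => ?_) hint (ae_of_all _ fun w => ?_)
    · refine (stronglyMeasurable_corrLimit hχ hb.continuous ζ₀).aestronglyMeasurable.mul ?_
      exact (Complex.continuous_ofReal.comp (by fun_prop)).aestronglyMeasurable
    · rw [norm_mul, Complex.norm_real, Real.norm_of_nonneg (Real.exp_nonneg _)]
      refine (mul_le_of_le_one_right (norm_nonneg _) (Real.exp_le_one_iff.2 ?_)).trans (hJ w)
      have := Real.pi_pos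
      rw [neg_mul, neg_nonpos]
      positivity
    · have h1 : Continuous fun ε : ℝ => corrLimit χ b ζ₀ w *
          (Real.exp (-(Real.pi * ε ^ 2) * ‖w‖ ^ 2) : ℂ) :=
        continuous_const.mul (Complex.continuous_ofReal.comp (by fun_prop))
      simpa using (h1.tendsto 0).mono_left nhdsWithin_le_nhds
  obtain ⟨c, hc0, hc⟩ := exists_le_integral_corrLimit_mul_gaussian hχ hχc hn hb.continuous hbc hb0
  have hL : c ≤ (∫ w, corrLimit χ b ζ₀ w).re :=
    ge_of_tendsto ((Complex.continuous_re.tendsto _).comp hlim2) hc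
  refine ⟨c / 2, by positivity, ?_⟩
  filter_upwards [hev, ((Complex.continuous_re.tendsto _).comp hlim).eventually_const_lt
    (show c / 2 < _ by linarith)] with p hp hp2
  have h3 := norm_sq_oscInt_smul hχ.continuous hb.continuous hbc hp.1 p.2
  rw [Function.comp_apply, ← h3, Complex.ofReal_re] at hp2
  exact hp2.le

end StationaryPhase

/-! ### Bounded densities from domination of measures -/

section RadonNikodym

open scoped NNReal

/-- A finite measure dominated by a multiple of `σ` has a bounded, integrable density. -/
theorem exists_density_of_le_smul {X : Type*} [MeasurableSpace X] {β σ : Measure X}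
    [IsFiniteMeasure β] [SigmaFinite σ] {C : ℝ≥0} (h : β ≤ C • σ) :
    ∃ f : X → ℝ, Integrable f σ ∧ MemLp f 2 σ ∧
      ∀ g : X → ℂ, ∫ x, g x * (f x : ℂ) ∂σ = ∫ x, g x ∂β := by
  set k := β.rnDeriv (C • σ) with hk
  have hkm : Measurable k := Measure.measurable_rnDeriv _ _
  have hk1 : ∀ᵐ x ∂(C • σ), k x ≤ 1 := Measure.rnDeriv_le_one_of_le h
  have hkβ : (C • σ).withDensity k = β :=
    Measure.withDensity_rnDeriv_eq _ _ (Measure.absolutelyContinuous_of_le h)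
  rcases eq_or_ne C 0 with hC0 | hC0
  · have hβ : β = 0 := by
      rw [hC0, zero_smul] at h
      exact le_antisymm h (Measure.zero_le _)
    exact ⟨fun _ => 0, integrable_zero _ _ _, MemLp.zero, fun g => by simp [hβ]⟩
  have hac : σ ≪ C • σ := Measure.absolutelyContinuous_smul (c := (C : ℝ≥0∞)) (by exact_mod_cast hC0)
  have hk1σ : ∀ᵐ x ∂σ, k x ≤ 1 := hac.ae_le hk1
  -- Density of `β` with respect to `σ`. It is integrable since `β` is finite, and square integrable
  -- since `p ≤ C` gives `p² ≤ C p`.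
  set p : X → ℝ≥0∞ := fun x => C * k x with hp
  have hpm : Measurable p := hkm.const_mul _
  have hpC : ∀ᵐ x ∂σ, p x ≤ C := hk1σ.mono fun x hx => mul_le_of_le_one_right' hx
  have hpβ : σ.withDensity p = β := by
    rw [← hkβ]
    change _ = ((C : ℝ≥0∞) • σ).withDensity k
    rw [withDensity_smul_measure, ← withDensity_smul _ hkm]
    rfl
  have hpt : ∀ᵐ x ∂σ, p x < ⊤ := hpC.mono fun x hx => hx.trans_lt ENNReal.coe_lt_top
  have hint : Integrable (fun x => (p x).toReal) σ := by
    refine integrable_toReal_of_lintegral_ne_top hpm.aemeasurable ?_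
    rw [← setLIntegral_univ, ← withDensity_apply _ MeasurableSet.univ, hpβ]
    exact measure_ne_top _ _
  refine ⟨fun x => (p x).toReal, hint, ?_, fun g => ?_⟩
  · rw [memLp_two_iff_integrable_sq_norm hint.aestronglyMeasurable]
    refine (hint.const_mul (C : ℝ)).mono' (hint.aestronglyMeasurable.norm.pow 2)
      (hpC.mono fun x hx => ?_)
    have h1 : (p x).toReal ≤ C := ENNReal.toReal_le_coe_of_le_coe hx
    rw [Real.norm_of_nonneg (by positivity), Real.norm_of_nonneg ENNReal.toReal_nonneg, sq]
    exact mul_le_mul_of_nonneg_right h1 ENNReal.toReal_nonneg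
  · rw [← hpβ, integral_withDensity_eq_integral_toReal_smul hpm hpt]
    congr 1
    ext x
    rw [Complex.real_smul, mul_comm]

end RadonNikodym

/-! ### The surface measure of a single patch -/

section Patch

variable {n d : ℕ} {U : Set (EuclideanSpace ℝ (Fin n))}
  {χ : EuclideanSpace ℝ (Fin n) → EuclideanSpace ℝ (Fin d)}

theorem firstFundamentalForm_det_pos {x : EuclideanSpace ℝ (Fin n)}
    (h : Function.Injective (fderiv ℝ χ x)) : 0 < (firstFundamentalForm χ x).det := by
  have h1 : LinearIndependent ℝ fun i : Fin n => fderiv ℝ χ x (EuclideanSpace.single i 1) := by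
    have h2 := (EuclideanSpace.basisFun (Fin n) ℝ).toBasis.linearIndependent.map'
      (fderiv ℝ χ x).toLinearMap (LinearMap.ker_eq_bot.2 h)
    simpa [Function.comp_def] using h2
  exact (Matrix.posDef_gram_of_linearIndependent h1).det_pos

theorem IsSmoothEmbedding.continuousOn_det (h : IsSmoothEmbedding U χ) :
    ContinuousOn (fun x => Real.sqrt (firstFundamentalForm χ x).det) U := by
  have h1 : ContinuousOn (fderiv ℝ χ) U := h.contDiffOn.continuousOn_fderiv_of_isOpen h.isOpen
    (by simp)
  refine Real.continuous_sqrt.comp_continuousOn (Continuous.comp_continuousOn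
    (continuous_id.matrix_det) ?_)
  refine continuousOn_pi.2 fun i => continuousOn_pi.2 fun j => ?_
  exact (h1.clm_apply continuousOn_const).inner (h1.clm_apply continuousOn_const)

theorem IsSmoothEmbedding.aemeasurable (h : IsSmoothEmbedding U χ)
    {ρ : EuclideanSpace ℝ (Fin n) → ℝ≥0∞} :
    AEMeasurable χ ((volume.restrict U).withDensity ρ) :=
  (h.contDiffOn.continuousOn.aemeasurable h.isOpen.measurableSet).mono_ac
    (withDensity_absolutelyContinuous _ _)

theorem IsSmoothEmbedding.injOn (h : IsSmoothEmbedding U χ) : InjOn χ U :=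
  injOn_iff_injective.2 h.isEmbedding.injective

theorem IsOpen.exists_iUnion_isCompact {E : Type*} [NormedAddCommGroup E] [NormedSpace ℝ E]
    [FiniteDimensional ℝ E] {U : Set E} (hU : IsOpen U) :
    ∃ K : ℕ → Set E, (∀ k, IsCompact (K k)) ∧ ⋃ k, K k = U := by
  have : ProperSpace E := FiniteDimensional.proper_real E
  have : LocallyCompactSpace U := hU.locallyCompactSpace
  have h : IsSigmaCompact U := isSigmaCompact_iff_sigmaCompactSpace.2 inferInstance
  exact h

theorem IsSmoothEmbedding.measurableSet_image (h : IsSmoothEmbedding U χ) :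
    MeasurableSet (χ '' U) := by
  obtain ⟨K, hK, hKU⟩ := IsOpen.exists_iUnion_isCompact h.isOpen
  rw [← hKU, image_iUnion]
  exact MeasurableSet.iUnion fun k => ((hK k).image_of_continuousOn
    (h.contDiffOn.continuousOn.mono (hKU ▸ subset_iUnion K k))).measurableSet

theorem IsSmoothEmbedding.patchMeasure_compl (h : IsSmoothEmbedding U χ) :
    patchMeasure U χ (χ '' U)ᶜ = 0 := by
  rw [patchMeasure, Measure.map_apply_of_aemeasurable h.aemeasurable h.measurableSet_image.compl]
  refine withDensity_absolutelyContinuous _ _ ?_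
  exact measure_mono_null (fun x hx hxU => hx ⟨x, hxU, rfl⟩)
    (ae_restrict_mem h.isOpen.measurableSet)

/-- The measure can be infinite, since nothing bounds the area element near the edge of `U`. It is
finite on images of compact subsets of `U`, where the area element is bounded, injectivity keeping
the preimage inside the compact set. -/
theorem IsSmoothEmbedding.sigmaFinite_patchMeasure (h : IsSmoothEmbedding U χ) :
    SigmaFinite (patchMeasure U χ) := by
  obtain ⟨K, hK, hKU⟩ := IsOpen.exists_iUnion_isCompact h.isOpen
  have hsub : ∀ k, K k ⊆ U := fun k => hKU ▸ subset_iUnion K k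
  refine Measure.sigmaFinite_of_countable (S := insert (χ '' U)ᶜ (range fun k => χ '' K k))
    ((countable_range _).insert _) ?_ ?_
  · rintro s (rfl | ⟨k, rfl⟩)
    · rw [h.patchMeasure_compl]
      exact ENNReal.zero_lt_top
    · have hc : MeasurableSet (χ '' K k) := ((hK k).image_of_continuousOn
        (h.contDiffOn.continuousOn.mono (hsub k))).measurableSet
      have hpre : χ ⁻¹' (χ '' K k) ∩ U ⊆ K k := by
        rintro x ⟨⟨y, hy, hyx⟩, hx⟩
        exact h.injOn (hsub k hy) hx hyx ▸ hy
      obtain ⟨C, hC⟩ := (hK k).exists_bound_of_continuousOn (h.continuousOn_det.mono (hsub k))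
      rw [patchMeasure, Measure.map_apply_of_aemeasurable h.aemeasurable hc,
        withDensity_apply' , Measure.restrict_restrict' h.isOpen.measurableSet]
      calc _ ≤ ∫⁻ x in K k, ENNReal.ofReal (Real.sqrt (firstFundamentalForm χ x).det) :=
            lintegral_mono_set hpre
        _ ≤ ∫⁻ x in K k, ENNReal.ofReal C := setLIntegral_mono' (hK k).measurableSet fun x hx =>
            ENNReal.ofReal_le_ofReal ((le_abs_self _).trans (hC x hx))
        _ < ⊤ := by
          rw [setLIntegral_const]
          exact ENNReal.mul_lt_top ENNReal.ofReal_lt_top (hK k).measure_lt_top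
  · rw [sUnion_insert, sUnion_range, ← image_iUnion, hKU, compl_union_self]

end Patch

/-! ### The weighted surface measure and test densities on one patch -/

section Surface

variable {n d M : ℕ} {U : Fin M → Set (EuclideanSpace ℝ (Fin n))}
  {χ : Fin M → EuclideanSpace ℝ (Fin n) → EuclideanSpace ℝ (Fin d)}

theorem multiplicity_le (p : EuclideanSpace ℝ (Fin d)) : multiplicity U χ p ≤ M :=
  (Set.ncard_le_card _).trans_eq (by simp)

theorem multiplicity_pos {p : EuclideanSpace ℝ (Fin d)} {i : Fin M} (h : p ∈ χ i '' U i) :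
    multiplicity U χ p ≠ 0 :=
  ((Set.ncard_pos (toFinite _)).2 ⟨i, h⟩).ne'

/-- The weight `m⁻¹` is infinite only where `m = 0`, and this set is null for every patch. -/
theorem sigmaFinite_surfaceMeasure (hemb : ∀ i, IsSmoothEmbedding (U i) (χ i)) :
    SigmaFinite (surfaceMeasure U χ) := by
  have h : ∀ i, SigmaFinite ((patchMeasure (U i) (χ i)).withDensity
      fun p => ((multiplicity U χ p : ℕ) : ℝ≥0∞)⁻¹) := by
    intro i
    have := (hemb i).sigmaFinite_patchMeasure
    refine SigmaFinite.withDensity_of_ne_top ?_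
    have h1 : ∀ᵐ p ∂patchMeasure (U i) (χ i), p ∈ χ i '' U i := by
      rw [ae_iff]
      exact (hemb i).patchMeasure_compl
    filter_upwards [h1] with p hp
    simpa using multiplicity_pos hp
  rw [surfaceMeasure, ← Measure.sum_fintype]
  infer_instance

/-- Since `m ≤ M`, the weight `m⁻¹` loses at most a factor `M`. Hence overlaps of patches need no
analysis. -/
theorem patchMeasure_le (i : Fin M) :
    patchMeasure (U i) (χ i) ≤ (M : NNReal) • surfaceMeasure U χ := by
  have hM : 0 < M := i.pos
  have h1 : patchMeasure (U i) (χ i) ≤ (M : ℝ≥0∞) • (patchMeasure (U i) (χ i)).withDensity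
      fun p => ((multiplicity U χ p : ℕ) : ℝ≥0∞)⁻¹ := by
    rw [← withDensity_smul' _ _ (ENNReal.natCast_ne_top M)]
    conv_lhs => rw [← withDensity_one (μ := patchMeasure (U i) (χ i))]
    refine withDensity_mono (ae_of_all _ fun p => ?_)
    simp only [Pi.one_apply, Pi.smul_apply, smul_eq_mul]
    calc (1 : ℝ≥0∞) = M * (M : ℝ≥0∞)⁻¹ :=
          (ENNReal.mul_inv_cancel (by exact_mod_cast hM.ne') (ENNReal.natCast_ne_top M)).symm
      _ ≤ _ := by
        gcongr
        exact multiplicity_le p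
  refine h1.trans ?_
  have h2 : (patchMeasure (U i) (χ i)).withDensity
      (fun p => ((multiplicity U χ p : ℕ) : ℝ≥0∞)⁻¹) ≤ surfaceMeasure U χ :=
    Finset.single_le_sum (f := fun i => (patchMeasure (U i) (χ i)).withDensity
      fun p => ((multiplicity U χ p : ℕ) : ℝ≥0∞)⁻¹) (fun _ _ => Measure.zero_le _)
      (Finset.mem_univ i)
  intro s
  simp only [Measure.smul_apply]
  exact mul_le_mul_right (h2 s) _

/-- A density on a parameter domain is pushed forward to an element of `L¹ ∩ L²` of the surface,
whose Fourier transform is an oscillatory integral. -/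
theorem exists_fourierTransform_eq_oscInt (hemb : ∀ i, IsSmoothEmbedding (U i) (χ i)) (i : Fin M)
    {b : EuclideanSpace ℝ (Fin n) → ℝ} (hb : Continuous b) (hb0 : ∀ x, 0 ≤ b x)
    (hbc : HasCompactSupport b) (hbU : tsupport b ⊆ U i) :
    ∃ f : EuclideanSpace ℝ (Fin d) → ℂ, Integrable f (surfaceMeasure U χ) ∧
      MemLp f 2 (surfaceMeasure U χ) ∧
      ∀ ξ, fourierTransform (surfaceMeasure U χ) f ξ = oscInt (χ i) b ξ := by
  have hi := hemb i
  have := sigmaFinite_surfaceMeasure hemb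
  set ρ : EuclideanSpace ℝ (Fin n) → ℝ≥0∞ := fun x => ENNReal.ofReal (b x) with hρ
  have hρm : Measurable ρ := hb.measurable.ennreal_ofReal
  set γ := (volume.restrict (U i)).withDensity ρ with hγ
  have hχγ : AEMeasurable (χ i) γ := hi.aemeasurable
  have hγfin : IsFiniteMeasure γ := by
    refine ⟨?_⟩
    rw [hγ, withDensity_apply _ MeasurableSet.univ, Measure.restrict_univ]
    refine lt_of_le_of_lt (setLIntegral_le_lintegral _ _) ?_
    have h1 := (hb.integrable_of_hasCompactSupport (μ := volume) hbc).2
    rw [hasFiniteIntegral_iff_ofReal (ae_of_all _ hb0)] at h1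
    exact h1
  -- The area element is positive and continuous on the compact support of `b`, so the quotient is
  -- bounded there.
  obtain ⟨C, hC⟩ : ∃ C : NNReal, ∀ x ∈ U i,
      b x ≤ C * Real.sqrt (firstFundamentalForm (χ i) x).det := by
    have hpos : ∀ x ∈ U i, 0 < Real.sqrt (firstFundamentalForm (χ i) x).det := fun x hx =>
      Real.sqrt_pos.2 (firstFundamentalForm_det_pos (hi.injective_fderiv x hx))
    have hK : IsCompact (tsupport b) := hbc
    obtain ⟨C, hC⟩ := hK.exists_bound_of_continuousOn (f := fun x =>
      b x / Real.sqrt (firstFundamentalForm (χ i) x).det)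
      (hb.continuousOn.div (hi.continuousOn_det.mono hbU) fun x hx => (hpos x (hbU hx)).ne')
    refine ⟨Real.toNNReal C, fun x hx => ?_⟩
    rw [← div_le_iff₀ (hpos x hx)]
    by_cases hxb : x ∈ tsupport b
    · exact ((le_abs_self _).trans (hC x hxb)).trans (Real.le_coe_toNNReal C)
    · rw [image_eq_zero_of_notMem_tsupport hxb, zero_div]
      exact NNReal.coe_nonneg _
  have hle1 : γ.map (χ i) ≤ C • patchMeasure (U i) (χ i) := by
    have h1 : γ ≤ (C : ℝ≥0∞) • (volume.restrict (U i)).withDensity fun x =>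
        ENNReal.ofReal (Real.sqrt (firstFundamentalForm (χ i) x).det) := by
      rw [← withDensity_smul' _ _ ENNReal.coe_ne_top]
      refine withDensity_mono ?_
      filter_upwards [ae_restrict_mem hi.isOpen.measurableSet] with x hx
      simp only [hρ, Pi.smul_apply, smul_eq_mul]
      rw [← ENNReal.ofReal_coe_nnreal, ← ENNReal.ofReal_mul (NNReal.coe_nonneg C)]
      exact ENNReal.ofReal_le_ofReal (hC x hx)
    refine (Measure.map_mono_of_aemeasurable h1 (hi.aemeasurable.smul_measure _)).trans ?_
    rw [Measure.map_smul]
    exact le_rfl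
  have hle : γ.map (χ i) ≤ (C * M : NNReal) • surfaceMeasure U χ := by
    refine hle1.trans ?_
    rw [mul_smul]
    intro s
    simp only [Measure.smul_apply]
    exact mul_le_mul_right (patchMeasure_le i s) _
  obtain ⟨f, hf1, hf2, hf⟩ := exists_density_of_le_smul hle
  refine ⟨fun x => (f x : ℂ), hf1.ofReal, hf2.ofReal, fun ξ => ?_⟩
  have hosc : Continuous fun x : EuclideanSpace ℝ (Fin d) => osc (inner ℝ x ξ) :=
    continuous_osc.comp (by fun_prop)
  calc _ = ∫ x, osc (inner ℝ x ξ) ∂(γ.map (χ i)) := hf _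
    _ = ∫ x, osc (inner ℝ (χ i x) ξ) ∂γ := integral_map hχγ hosc.aestronglyMeasurable
    _ = ∫ x in U i, osc (inner ℝ (χ i x) ξ) * (b x : ℂ) := by
      rw [hγ, integral_withDensity_eq_integral_toReal_smul hρm
        (ae_of_all _ fun x => ENNReal.ofReal_lt_top)]
      congr 1
      ext x
      rw [ENNReal.toReal_ofReal (hb0 x), Complex.real_smul, mul_comm]
    _ = _ := setIntegral_eq_integral_of_forall_compl_eq_zero fun x hx => by
      rw [image_eq_zero_of_notMem_tsupport fun h => hx (hbU h)]
      simp

end Surface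

/-! ### Averaging the decay weight over large balls -/

section Averaging

variable {F : Type*} [NormedAddCommGroup F] [InnerProductSpace ℝ F] [FiniteDimensional ℝ F]
  [MeasurableSpace F] [BorelSpace F]

/-- The weight `(1 + ‖ξ‖)^{-n}`. -/
noncomputable def decayWeight (n : ℕ) (ξ : F) : ℝ := ((1 + ‖ξ‖) ^ n)⁻¹

theorem decayWeight_nonneg {F : Type*} [NormedAddCommGroup F] (n : ℕ) (ξ : F) :
    0 ≤ decayWeight n ξ := by
  unfold decayWeight
  positivity

theorem decayWeight_pos {F : Type*} [NormedAddCommGroup F] (n : ℕ) (ξ : F) :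
    0 < decayWeight n ξ := by
  unfold decayWeight
  positivity

theorem continuous_decayWeight {F : Type*} [NormedAddCommGroup F] (n : ℕ) :
    Continuous (decayWeight n : F → ℝ) := by
  unfold decayWeight
  refine Continuous.inv₀ (by fun_prop) fun ξ => ?_
  positivity

/-- The average of the weight `decayWeight n (x - ·)` over the ball of radius `R`. -/
noncomputable def avgWeight (n : ℕ) (R : ℝ) (x : F) : ℝ :=
  ((volume : Measure F).real (ball 0 R))⁻¹ * ∫ ξ in ball (0 : F) R, decayWeight n (x - ξ)

theorem integrableOn_decayWeight (n : ℕ) (R : ℝ) (x : F) :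
    IntegrableOn (fun ξ => decayWeight n (x - ξ)) (ball 0 R) :=
  (((continuous_decayWeight n).comp (continuous_const.sub continuous_id)).continuousOn.integrableOn_compact
    (isCompact_closedBall 0 R)).mono_set ball_subset_closedBall

theorem avgWeight_nonneg (n : ℕ) (R : ℝ) (x : F) : 0 ≤ avgWeight n R x :=
  mul_nonneg (by positivity) (integral_nonneg fun _ => decayWeight_nonneg _ _)

theorem volume_real_ball_pos {R : ℝ} (hR : 0 < R) : 0 < (volume : Measure F).real (ball 0 R) :=
  ENNReal.toReal_pos (measure_ball_pos _ _ hR).ne' measure_ball_lt_top.ne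

/-- Pointwise: `|ξ| < R ≤ |x|/2` gives `1 + |x - ξ| ≥ (1 + |x|)/2`. -/
theorem avgWeight_le_of_two_mul_le (n : ℕ) {R : ℝ} (hR : 0 < R) {x : F} (hx : 2 * R ≤ ‖x‖) :
    avgWeight n R x ≤ 2 ^ n * decayWeight n x := by
  have hV := volume_real_ball_pos (F := F) hR
  rw [avgWeight, inv_mul_le_iff₀ hV]
  calc _ ≤ ∫ ξ in ball (0 : F) R, 2 ^ n * decayWeight n x := by
        refine setIntegral_mono_on (integrableOn_decayWeight n R x)
          (integrableOn_const measure_ball_lt_top.ne) measurableSet_ball fun ξ hξ => ?_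
        rw [mem_ball_zero_iff] at hξ
        have h1 : ‖x‖ - ‖ξ‖ ≤ ‖x - ξ‖ := norm_sub_norm_le x ξ
        simp only [decayWeight]
        rw [← div_eq_mul_inv, inv_le_comm₀ (by positivity) (by positivity), inv_div, ← div_pow]
        gcongr
        rw [div_le_iff₀ two_pos]
        linarith
    _ = _ := by rw [setIntegral_const, smul_eq_mul]

/-- Here `|x - ξ| < 3R`, and in polar coordinates the radial integrand `rⁿ (1 + r)⁻ⁿ` is at most
`1`, so the integral is at most `3R (n + 1) |B₁|`. Dividing by `|B_R| = R^{n+1} |B₁|` leaves `R⁻ⁿ`.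
-/
theorem avgWeight_le_of_le_two_mul {n : ℕ} (hn : Module.finrank ℝ F = n + 1) {R : ℝ} (hR : 0 < R)
    {x : F} (hx : ‖x‖ ≤ 2 * R) : avgWeight n R x ≤ 3 * (n + 1) * (R ^ n)⁻¹ := by
  have : Nontrivial F := Module.nontrivial_of_finrank_pos (R := ℝ) (by omega)
  have hV := volume_real_ball_pos (F := F) hR
  have hV1 := volume_real_ball_pos (F := F) one_pos
  rw [avgWeight, inv_mul_le_iff₀ hV]
  let k : ℝ → ℝ := indicator (Iio (3 * R)) fun t => ((1 + t) ^ n)⁻¹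
  have hk0 : ∀ t, 0 ≤ t → 0 ≤ k t := fun t ht => by
    simp only [k, indicator_apply]
    split_ifs
    · positivity
    · exact le_rfl
  have hk : ∀ ξ ∈ ball (0 : F) R, decayWeight n (x - ξ) = k ‖x - ξ‖ := by
    intro ξ hξ
    rw [mem_ball_zero_iff] at hξ
    have h1 : ‖x - ξ‖ < 3 * R := (norm_sub_le x ξ).trans_lt (by linarith)
    simp only [k]
    rw [indicator_of_mem (by exact h1)]
    rfl
  have hkint : Integrable fun η : F => k ‖η‖ := by
    have h2 : (fun η : F => k ‖η‖) = indicator (ball 0 (3 * R)) (decayWeight n) := by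
      ext η
      by_cases h : ‖η‖ < 3 * R
      · rw [indicator_of_mem (by simpa using h)]
        simp only [k]
        rw [indicator_of_mem (by exact h)]
        rfl
      · rw [indicator_of_notMem (by simpa using h)]
        simp only [k]
        rw [indicator_of_notMem (by exact h)]
    rw [h2, integrable_indicator_iff measurableSet_ball]
    exact ((continuous_decayWeight n).continuousOn.integrableOn_compact
      (isCompact_closedBall 0 (3 * R))).mono_set ball_subset_closedBall
  have hpolar : ∫ y in Ioi (0 : ℝ), y ^ n • k y ≤ 3 * R := by
    have h3 : ∫ y in Ioi (0 : ℝ), y ^ n • k y = ∫ y in Ioo 0 (3 * R), y ^ n * ((1 + y) ^ n)⁻¹ := by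
      have h4 : (fun y : ℝ => y ^ n • k y) =
          indicator (Iio (3 * R)) fun y => y ^ n * ((1 + y) ^ n)⁻¹ := by
        ext y
        by_cases h : y ∈ Iio (3 * R) <;> simp [k, h]
      rw [h4, setIntegral_indicator measurableSet_Iio]
      rfl
    rw [h3]
    have h5 : ‖∫ y in Ioo 0 (3 * R), y ^ n * ((1 + y) ^ n)⁻¹‖ ≤
        1 * (volume : Measure ℝ).real (Ioo 0 (3 * R)) := by
      refine norm_setIntegral_le_of_norm_le_const measure_Ioo_lt_top fun y hy => ?_
      have hy0 : 0 < y := hy.1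
      rw [Real.norm_of_nonneg (by positivity), ← div_eq_mul_inv, div_le_one (by positivity)]
      gcongr
      linarith
    rw [one_mul, Real.volume_real_Ioo_of_le (by linarith), sub_zero] at h5
    exact (le_abs_self _).trans h5
  calc _ = ∫ ξ in ball (0 : F) R, k ‖x - ξ‖ := setIntegral_congr_fun measurableSet_ball hk
    _ ≤ ∫ ξ : F, k ‖x - ξ‖ := setIntegral_le_integral (hkint.comp_sub_left x)
        (ae_of_all _ fun ξ => hk0 _ (norm_nonneg _))
    _ = ∫ ξ : F, k ‖ξ‖ := integral_sub_left_eq_self (fun η : F => k ‖η‖) _ x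
    _ = (n + 1) * ((volume : Measure F).real (ball 0 1) *
        ∫ y in Ioi (0 : ℝ), y ^ n • k y) := by
      rw [integral_fun_norm_addHaar, hn, Nat.add_sub_cancel, nsmul_eq_mul, smul_eq_mul]
      push_cast
      rfl
    _ ≤ (n + 1) * ((volume : Measure F).real (ball 0 1) * (3 * R)) := by gcongr
    _ = _ := by
      rw [measureReal_def volume (ball (0 : F) R), Measure.addHaar_ball_of_pos _ _ hR,
        ENNReal.toReal_mul, ENNReal.toReal_ofReal (by positivity), ← measureReal_def, hn, pow_succ]
      field_simp

/-- If the weights `(1 + ‖l‖)^{-n}` are summable over `Λ` in dimension `n + 1`, then the sum of the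
weights seen from another point can be arbitrarily small. -/
theorem exists_tsum_decayWeight_sub_lt {n : ℕ} (hn0 : n ≠ 0) (hn : Module.finrank ℝ F = n + 1)
    {Λ : Set F} (hΛ : ∑' l : Λ, ENNReal.ofReal (decayWeight n (l : F)) ≠ ⊤) {a : ℝ≥0∞}
    (ha : a ≠ 0) : ∃ ξ : F, ∑' l : Λ, ENNReal.ofReal (decayWeight n ((l : F) - ξ)) < a := by
  by_contra! hcon
  -- Countability permits exchanging the sum with the integral over the ball below.
  have hcount : Countable Λ := by
    have h := Summable.countable_support_ennreal hΛ
    have h2 : Function.support (fun l : Λ => ENNReal.ofReal (decayWeight n (l : F))) = univ :=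
      eq_univ_of_forall fun l => by simpa using decayWeight_pos n (l : F)
    rw [h2] at h
    exact countable_univ_iff.1 h
  have hsum : Summable fun l : Λ => decayWeight n (l : F) :=
    (ENNReal.summable_toReal hΛ).congr fun l => ENNReal.toReal_ofReal (decayWeight_nonneg _ _)
  -- Majorant independent of `R`: if `|l| ≤ 2R` and `R ≥ 1`, then `1 + |l| ≤ 3R`, which turns `R⁻ⁿ`
  -- into at most `3ⁿ (1 + |l|)⁻ⁿ`.
  have hbound : ∀ R : ℝ, 1 ≤ R → ∀ l : Λ, ‖avgWeight n R (l : F)‖ ≤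
      (3 * (n + 1) * 3 ^ n) * decayWeight n (l : F) := by
    intro R hR l
    rw [Real.norm_of_nonneg (avgWeight_nonneg _ _ _)]
    have hn1 : (1 : ℝ) ≤ n + 1 := by linarith [n.cast_nonneg (α := ℝ)]
    rcases le_total (2 * R) ‖(l : F)‖ with h | h
    · refine (avgWeight_le_of_two_mul_le n (by linarith) h).trans ?_
      refine mul_le_mul_of_nonneg_right ?_ (decayWeight_nonneg _ _)
      calc (2 : ℝ) ^ n ≤ 3 ^ n := by gcongr; norm_num
        _ ≤ (3 * (n + 1)) * 3 ^ n := le_mul_of_one_le_left (by positivity) (by linarith)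
    · refine (avgWeight_le_of_le_two_mul hn (by linarith) h).trans ?_
      rw [mul_assoc (3 * ((n : ℝ) + 1))]
      refine mul_le_mul_of_nonneg_left ?_ (by positivity)
      rw [decayWeight, ← div_eq_mul_inv, inv_le_comm₀ (by positivity) (by positivity), inv_div,
        ← div_pow]
      gcongr
      rw [div_le_iff₀ three_pos]
      linarith
  have htend : ∀ l : Λ, Tendsto (fun R => avgWeight n R (l : F)) atTop (𝓝 0) := by
    intro l
    have h1 : Tendsto (fun R : ℝ => 3 * ((n : ℝ) + 1) * (R ^ n)⁻¹) atTop (𝓝 0) := by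
      simpa using ((tendsto_pow_atTop hn0).inv_tendsto_atTop (𝕜 := ℝ)).const_mul (3 * ((n : ℝ) + 1))
    refine squeeze_zero' (Eventually.of_forall fun R => avgWeight_nonneg _ _ _) ?_ h1
    filter_upwards [eventually_ge_atTop (‖(l : F)‖ / 2), eventually_gt_atTop 0] with R hR hR0
    exact avgWeight_le_of_le_two_mul hn hR0 (by linarith)
  have hlim := tendsto_tsum_of_dominated_convergence (hsum.mul_left (3 * ((n : ℝ) + 1) * 3 ^ n)) htend
    ((eventually_ge_atTop 1).mono hbound)
  rw [tsum_zero] at hlim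
  -- Averaging the assumed lower bound `a` over the ball preserves it, against the limit `0` just
  -- found.
  have hle : ∀ R : ℝ, 1 ≤ R → a ≤ ENNReal.ofReal (∑' l : Λ, avgWeight n R (l : F)) := by
    intro R hR
    have hR0 : 0 < R := by linarith
    have hV : (volume : Measure F) (ball 0 R) ≠ 0 := (measure_ball_pos _ _ hR0).ne'
    have hV' : (volume : Measure F) (ball 0 R) ≠ ⊤ := measure_ball_lt_top.ne
    have hsR : Summable fun l : Λ => avgWeight n R (l : F) :=
      Summable.of_norm_bounded (hsum.mul_left _) (hbound R hR)
    rw [ENNReal.ofReal_tsum_of_nonneg (fun _ => avgWeight_nonneg _ _ _) hsR]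
    have h1 : ∀ l : Λ, ENNReal.ofReal (avgWeight n R (l : F)) =
        ((volume : Measure F) (ball 0 R))⁻¹ *
          ∫⁻ ξ in ball (0 : F) R, ENNReal.ofReal (decayWeight n ((l : F) - ξ)) := by
      intro l
      rw [avgWeight, ENNReal.ofReal_mul (by positivity),
        ofReal_integral_eq_lintegral_ofReal (integrableOn_decayWeight n R _)
          (ae_of_all _ fun _ => decayWeight_nonneg _ _),
        ENNReal.ofReal_inv_of_pos (volume_real_ball_pos hR0), ofReal_measureReal hV']
    simp_rw [h1]
    rw [ENNReal.tsum_mul_left, ← lintegral_tsum]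
    · calc a = ((volume : Measure F) (ball 0 R))⁻¹ * ∫⁻ _ in ball (0 : F) R, a := by
            rw [setLIntegral_const, mul_comm a, ← mul_assoc, ENNReal.inv_mul_cancel hV hV', one_mul]
        _ ≤ _ := by
          gcongr with ξ
          exact hcon ξ
    · intro l
      exact ((continuous_decayWeight n).comp
        (continuous_const.sub continuous_id)).measurable.ennreal_ofReal.aemeasurable
  have hlim' := (ENNReal.continuous_ofReal.tendsto 0).comp hlim
  rw [ENNReal.ofReal_zero] at hlim'
  have := ge_of_tendsto hlim' ((eventually_ge_atTop 1).mono hle)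
  exact ha (le_antisymm this zero_le)

end Averaging

/-! ### Local structure of a patch: cut-offs and curvature -/

theorem oscInt_congr {E F : Type*} [NormedAddCommGroup E] [InnerProductSpace ℝ E]
    [FiniteDimensional ℝ E] [NormedAddCommGroup F] [InnerProductSpace ℝ F] [MeasurableSpace E]
    [BorelSpace E] {χ χ' : E → F} {b : E → ℝ} (h : EqOn χ' χ (tsupport b)) (ξ : F) :
    oscInt χ' b ξ = oscInt χ b ξ := by
  refine integral_congr_ae (ae_of_all _ fun y => ?_)
  simp only
  by_cases hy : y ∈ tsupport b
  · rw [h hy]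
  · rw [image_eq_zero_of_notMem_tsupport hy]
    simp

section LocalGeometry

variable {n d : ℕ} {U : Set (EuclideanSpace ℝ (Fin n))}
  {χ : EuclideanSpace ℝ (Fin n) → EuclideanSpace ℝ (Fin d)}

/-- Nonvanishing curvature means that the second fundamental form is a nondegenerate bilinear
form. -/
theorem HasNonvanishingGaussianCurvature.nondegenerate
    (h : HasNonvanishingGaussianCurvature U χ) {u : EuclideanSpace ℝ (Fin n)} (hu : u ∈ U)
    {ν : EuclideanSpace ℝ (Fin d)} (hν : IsUnitNormal χ u ν) {θ : EuclideanSpace ℝ (Fin n)}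
    (hθ : θ ≠ 0) : ∃ e, inner ℝ (fderiv ℝ (fderiv ℝ χ) u θ e) ν ≠ 0 := by
  by_contra! hcon
  have hdet : (secondFundamentalForm χ ν u).det ≠ 0 := fun h0 =>
    h u hu ν hν (by rw [gaussianCurvature, h0, zero_div])
  refine hθ ?_
  -- A direction pairing to zero with every `e` is a left null vector of the second fundamental
  -- form.
  have hvec : Matrix.vecMul (fun i => θ i) (secondFundamentalForm χ ν u) = 0 := by
    ext j
    have hsum : θ = ∑ i, θ i • EuclideanSpace.single i (1 : ℝ) := by
      simpa using ((EuclideanSpace.basisFun (Fin n) ℝ).sum_repr θ).symm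
    have h1 := hcon (EuclideanSpace.single j 1)
    rw [hsum, map_sum, sum_apply, sum_inner] at h1
    simp only [map_smul, smul_apply, inner_smul_left, RCLike.conj_to_real] at h1
    simpa [Matrix.vecMul, dotProduct, secondFundamentalForm] using h1
  have h0 := Matrix.eq_zero_of_vecMul_eq_zero hdet hvec
  ext i
  exact congrFun h0 i

/-- Near a point of its domain, a smooth embedding agrees with a smooth compactly supported map. -/
theorem IsSmoothEmbedding.exists_cutoff (h : IsSmoothEmbedding U χ)
    {u : EuclideanSpace ℝ (Fin n)} (hu : u ∈ U) :
    ∃ χ' : EuclideanSpace ℝ (Fin n) → EuclideanSpace ℝ (Fin d), ContDiff ℝ ∞ χ' ∧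
      HasCompactSupport χ' ∧ ∃ r > 0, closedBall u r ⊆ U ∧ EqOn χ' χ (closedBall u r) := by
  obtain ⟨r, hr, hrU⟩ := Metric.nhds_basis_closedBall.mem_iff.1 (h.isOpen.mem_nhds hu)
  let η : ContDiffBump u := ⟨r / 2, r, by positivity, by linarith⟩
  refine ⟨fun y => η y • χ y, ?_, ?_, r / 2, by positivity,
    (closedBall_subset_closedBall (by linarith)).trans hrU, fun y hy => ?_⟩
  · rw [contDiff_iff_contDiffAt]
    intro y
    by_cases hy : y ∈ U
    · exact η.contDiff.contDiffAt.smul (h.contDiffOn.contDiffAt (h.isOpen.mem_nhds hy))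
    · have h1 : y ∉ tsupport η := fun h2 => hy (hrU (by rwa [η.tsupport_eq] at h2))
      refine contDiffAt_const (c := (0 : EuclideanSpace ℝ (Fin d))) |>.congr_of_eventuallyEq ?_
      filter_upwards [(isClosed_tsupport η).isOpen_compl.mem_nhds h1] with z hz
      rw [image_eq_zero_of_notMem_tsupport hz, zero_smul]
  · exact η.hasCompactSupport.smul_right
  · simp only
    rw [η.one_of_mem_closedBall hy, one_smul]

end LocalGeometry

/-! ### Modulation as translation of the transform -/

section Modulation

variable {d : ℕ} {σ : Measure (EuclideanSpace ℝ (Fin d))}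

/-- The modulation `x ↦ e^{2πi x·ξ} f(x)`. -/
noncomputable def modulate (ξ : EuclideanSpace ℝ (Fin d)) (f : EuclideanSpace ℝ (Fin d) → ℂ)
    (x : EuclideanSpace ℝ (Fin d)) : ℂ := osc (-inner ℝ x ξ) * f x

theorem aestronglyMeasurable_modulate {f : EuclideanSpace ℝ (Fin d) → ℂ}
    (hf : AEStronglyMeasurable f σ) (ξ : EuclideanSpace ℝ (Fin d)) :
    AEStronglyMeasurable (modulate ξ f) σ :=
  (continuous_osc.comp (by fun_prop : Continuous fun x : EuclideanSpace ℝ (Fin d) =>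
    -inner ℝ x ξ)).aestronglyMeasurable.mul hf

theorem norm_modulate (ξ : EuclideanSpace ℝ (Fin d)) (f : EuclideanSpace ℝ (Fin d) → ℂ)
    (x : EuclideanSpace ℝ (Fin d)) : ‖modulate ξ f x‖ = ‖f x‖ := by
  rw [modulate, norm_mul, norm_osc, one_mul]

theorem integrable_modulate {f : EuclideanSpace ℝ (Fin d) → ℂ} (hf : Integrable f σ)
    (ξ : EuclideanSpace ℝ (Fin d)) : Integrable (modulate ξ f) σ :=
  hf.mono (aestronglyMeasurable_modulate hf.1 ξ) (ae_of_all _ fun x => (norm_modulate ξ f x).le)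

theorem memLp_modulate {f : EuclideanSpace ℝ (Fin d) → ℂ} (hf : MemLp f 2 σ)
    (ξ : EuclideanSpace ℝ (Fin d)) : MemLp (modulate ξ f) 2 σ :=
  hf.mono (aestronglyMeasurable_modulate hf.1 ξ) (ae_of_all _ fun x => (norm_modulate ξ f x).le)

theorem eLpNorm_modulate (f : EuclideanSpace ℝ (Fin d) → ℂ) (ξ : EuclideanSpace ℝ (Fin d)) :
    eLpNorm (modulate ξ f) 2 σ = eLpNorm f 2 σ :=
  eLpNorm_congr_norm_ae (ae_of_all _ fun x => norm_modulate ξ f x)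

theorem fourierTransform_modulate (f : EuclideanSpace ℝ (Fin d) → ℂ)
    (ξ l : EuclideanSpace ℝ (Fin d)) :
    fourierTransform σ (modulate ξ f) l = fourierTransform σ f (l - ξ) := by
  refine integral_congr_ae (ae_of_all _ fun x => ?_)
  change osc (inner ℝ x l) * (osc (-inner ℝ x ξ) * f x) = osc (inner ℝ x (l - ξ)) * f x
  rw [inner_sub_right, sub_eq_add_neg, osc_add, mul_assoc]

theorem continuous_fourierTransform {f : EuclideanSpace ℝ (Fin d) → ℂ} (hf : Integrable f σ) :
    Continuous (fourierTransform σ f) := by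
  refine continuous_of_dominated (F := fun ξ x => osc (inner ℝ x ξ) * f x) (bound := fun x => ‖f x‖)
    (fun ξ => ?_) (fun ξ => ae_of_all _ fun x => ?_) hf.norm (ae_of_all _ fun x => ?_)
  · exact (continuous_osc.comp (by fun_prop : Continuous fun x : EuclideanSpace ℝ (Fin d) =>
      inner ℝ x ξ)).aestronglyMeasurable.mul hf.1
  · rw [norm_mul, norm_osc, one_mul]
  · exact (continuous_osc.comp (by fun_prop)).mul continuous_const

end Modulation

/-! ### Test functions on the surface with prescribed decay -/

section TestFunctions

variable {n d M : ℕ} {U : Fin M → Set (EuclideanSpace ℝ (Fin n))}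
  {χ : Fin M → EuclideanSpace ℝ (Fin n) → EuclideanSpace ℝ (Fin d)}

/-- There is a test function on the surface whose Fourier transform decays like
`(1 + ‖ξ‖)^{-n/2}`. -/
theorem exists_fourierTransform_decay (hemb : ∀ i, IsSmoothEmbedding (U i) (χ i))
    (hcurv : ∀ i, HasNonvanishingGaussianCurvature (U i) (χ i)) (hne : (surface U χ).Nonempty) :
    ∃ f : EuclideanSpace ℝ (Fin d) → ℂ, Integrable f (surfaceMeasure U χ) ∧
      MemLp f 2 (surfaceMeasure U χ) ∧ fourierTransform (surfaceMeasure U χ) f 0 ≠ 0 ∧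
      ∃ C, ∀ ξ, ‖fourierTransform (surfaceMeasure U χ) f ξ‖ ^ 2 ≤ C * decayWeight n ξ := by
  obtain ⟨p, hp⟩ := hne
  obtain ⟨i, u, hu, rfl⟩ := mem_iUnion.1 hp
  obtain ⟨χ', hχ', hχc, r₀, hr₀, hrU, heq⟩ := (hemb i).exists_cutoff hu
  have hev : χ' =ᶠ[𝓝 u] χ i := heq.eventuallyEq_of_mem (closedBall_mem_nhds _ hr₀)
  have hfr : Module.finrank ℝ (EuclideanSpace ℝ (Fin n)) = n := by simp
  have hcomp : ∃ r > 0, ∀ b : EuclideanSpace ℝ (Fin n) → ℝ, ContDiff ℝ ∞ b →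
      tsupport b ⊆ closedBall u r → ∃ C, ∀ T ≥ 1, ∀ ζ ∈ sphere (0 : EuclideanSpace ℝ (Fin d)) 1,
        (T : ℝ) ^ n * ‖oscInt χ' b (T • ζ)‖ ^ 2 ≤ C := by
    refine (isCompact_sphere (0 : EuclideanSpace ℝ (Fin d)) 1).induction_on
      (p := fun V => ∃ r > 0, ∀ b : EuclideanSpace ℝ (Fin n) → ℝ, ContDiff ℝ ∞ b →
      tsupport b ⊆ closedBall u r → ∃ C, ∀ T ≥ 1, ∀ ζ ∈ V,
        (T : ℝ) ^ n * ‖oscInt χ' b (T • ζ)‖ ^ 2 ≤ C) ?_ ?_ ?_ ?_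
    · exact ⟨1, one_pos, fun b _ _ => ⟨0, by simp⟩⟩
    · rintro V V' hVV ⟨r, hr, H⟩
      refine ⟨r, hr, fun b hb hbs => ?_⟩
      obtain ⟨C, hC⟩ := H b hb hbs
      exact ⟨C, fun T hT ζ hζ => hC T hT ζ (hVV hζ)⟩
    · rintro V V' ⟨r, hr, H⟩ ⟨r', hr', H'⟩
      refine ⟨min r r', lt_min hr hr', fun b hb hbs => ?_⟩
      obtain ⟨C, hC⟩ := H b hb (hbs.trans (closedBall_subset_closedBall (min_le_left _ _)))
      obtain ⟨C', hC'⟩ := H' b hb (hbs.trans (closedBall_subset_closedBall (min_le_right _ _)))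
      refine ⟨max C C', fun T hT ζ hζ => ?_⟩
      rcases hζ with hζ | hζ
      · exact (hC T hT ζ hζ).trans (le_max_left _ _)
      · exact (hC' T hT ζ hζ).trans (le_max_right _ _)
    · intro ζ hζ
      obtain ⟨r, hr, W, hW, H⟩ : ∃ r > 0, ∃ W ∈ 𝓝 ζ, ∀ b : EuclideanSpace ℝ (Fin n) → ℝ,
          ContDiff ℝ ∞ b → tsupport b ⊆ closedBall u r → ∃ C, ∀ T ≥ 1, ∀ ω' ∈ W,
          (T : ℝ) ^ Module.finrank ℝ (EuclideanSpace ℝ (Fin n)) *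
            ‖oscInt χ' b (T • ω')‖ ^ 2 ≤ C := by
        -- Either `ζ` is not normal at `u` and the phase is nonstationary, or `ζ` is a unit normal
        -- and the curvature makes the Hessian nondegenerate.
        by_cases hnorm : ∃ e, inner ℝ (fderiv ℝ χ' u e) ζ ≠ 0
        · obtain ⟨e, he⟩ := hnorm
          exact exists_oscInt_le_of_nonstationary hχ' hχc he
        · push Not at hnorm
          rw [hev.fderiv_eq] at hnorm
          have hν : IsUnitNormal (χ i) u ζ := ⟨mem_sphere_zero_iff_norm.1 hζ, hnorm⟩
          refine exists_oscInt_le_of_nondegenerate hχ' hχc fun θ hθ => ?_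
          rw [hev.fderiv.fderiv_eq]
          exact (hcurv i).nondegenerate hu hν hθ
      rw [hfr] at H
      refine ⟨W, mem_nhdsWithin_of_mem_nhds hW, r, hr, H⟩
  obtain ⟨r, hr, H⟩ := hcomp
  have hm : 0 < min r r₀ := lt_min hr hr₀
  let b : ContDiffBump u := ⟨min r r₀ / 2, min r r₀, by positivity, by linarith⟩
  have hbs : tsupport b = closedBall u (min r r₀) := b.tsupport_eq
  obtain ⟨C, hC⟩ := H b b.contDiff (hbs ▸ closedBall_subset_closedBall (min_le_left _ _))
  have hbr : tsupport b ⊆ closedBall u r₀ := hbs ▸ closedBall_subset_closedBall (min_le_right _ _)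
  obtain ⟨f, hf1, hf2, hf⟩ := exists_fourierTransform_eq_oscInt hemb i b.continuous
    (fun x => b.nonneg) b.hasCompactSupport (hbr.trans hrU)
  -- The first constant serves `|ξ| ≥ 1`; the second is the trivial `L¹` bound for `|ξ| < 1`.
  refine ⟨f, hf1, hf2, ?_, max (C * 2 ^ n) ((∫ x, ‖f x‖ ∂surfaceMeasure U χ) ^ 2 * 2 ^ n),
    fun ξ => ?_⟩
  · have h0 : oscInt (χ i) b 0 = ((∫ x, b x : ℝ) : ℂ) := by
      simp only [oscInt, inner_zero_right, osc_zero, one_mul]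
      exact integral_ofReal
    rw [hf, h0]
    exact_mod_cast b.integral_pos.ne'
  · rcases le_or_gt 1 ‖ξ‖ with hξ | hξ
    · have hξ0 : 0 < ‖ξ‖ := by linarith
      have h1 := hC ‖ξ‖ hξ (‖ξ‖⁻¹ • ξ)
        (by rw [mem_sphere_zero_iff_norm, norm_smul, norm_inv, norm_norm, inv_mul_cancel₀ hξ0.ne'])
      rw [smul_smul, mul_inv_cancel₀ hξ0.ne', one_smul, oscInt_congr (heq.mono hbr), ← hf] at h1
      have hC0 : 0 ≤ C := le_trans (by positivity) h1
      refine le_trans ?_ (mul_le_mul_of_nonneg_right (le_max_left _ _) (decayWeight_nonneg _ _))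
      rw [decayWeight, ← div_eq_mul_inv, le_div_iff₀ (by positivity)]
      calc _ ≤ ‖fourierTransform (surfaceMeasure U χ) f ξ‖ ^ 2 * (2 * ‖ξ‖) ^ n := by
            gcongr
            linarith
        _ = (‖ξ‖ ^ n * ‖fourierTransform (surfaceMeasure U χ) f ξ‖ ^ 2) * 2 ^ n := by
          rw [mul_pow]
          ring
        _ ≤ _ := by gcongr
    · refine le_trans ?_ (mul_le_mul_of_nonneg_right (le_max_right _ _) (decayWeight_nonneg _ _))
      rw [decayWeight, ← div_eq_mul_inv, le_div_iff₀ (by positivity)]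
      have h2 : ‖fourierTransform (surfaceMeasure U χ) f ξ‖ ≤
          ∫ x, ‖f x‖ ∂surfaceMeasure U χ := by
        refine norm_integral_le_of_norm_le hf1.norm (ae_of_all _ fun x => ?_)
        change ‖osc (inner ℝ x ξ) * f x‖ ≤ _
        rw [norm_mul, norm_osc, one_mul]
      gcongr
      linarith

/-- For each direction `ζ` there is a test function on a compact surface whose Fourier transform is
at least of the order `T^{-n/2}` near `ζ`. -/
theorem exists_le_fourierTransform (hemb : ∀ i, IsSmoothEmbedding (U i) (χ i))
    (hcurv : ∀ i, HasNonvanishingGaussianCurvature (U i) (χ i)) (hne : (surface U χ).Nonempty)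
    (hcompact : IsCompact (surface U χ)) {ζ : EuclideanSpace ℝ (Fin d)} (hζ : ‖ζ‖ = 1) :
    ∃ f : EuclideanSpace ℝ (Fin d) → ℂ, Integrable f (surfaceMeasure U χ) ∧
      MemLp f 2 (surfaceMeasure U χ) ∧ ∃ c > 0, ∀ᶠ p in (atTop : Filter ℝ) ×ˢ 𝓝 ζ,
        c ≤ p.1 ^ n * ‖fourierTransform (surfaceMeasure U χ) f (p.1 • p.2)‖ ^ 2 := by
  -- This is where compactness of the surface enters: at a highest point in direction `ζ`, every
  -- patch through it has `ζ` as normal. Any one such patch suffices.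
  obtain ⟨p, hp, hmax⟩ := hcompact.exists_isMaxOn hne
    (f := fun x => inner ℝ x ζ) (by fun_prop)
  obtain ⟨i, u, hu, rfl⟩ := mem_iUnion.1 hp
  obtain ⟨χ', hχ', hχc, r₀, hr₀, hrU, heq⟩ := (hemb i).exists_cutoff hu
  have hev : χ' =ᶠ[𝓝 u] χ i := heq.eventuallyEq_of_mem (closedBall_mem_nhds _ hr₀)
  have hloc : IsLocalMax (fun y => (inner ℝ (χ' y) ζ : ℝ)) u := by
    filter_upwards [hev, (hemb i).isOpen.mem_nhds hu] with y hy hyU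
    rw [hy, hev.eq_of_nhds]
    exact hmax (mem_iUnion.2 ⟨i, y, hyU, rfl⟩)
  have hn : ∀ e, inner ℝ (fderiv ℝ χ' u e) ζ = 0 := fun e => by
    rw [← fderiv_inner_const (hχ'.differentiable (by simp)), hloc.fderiv_eq_zero]
    rfl
  have hν : IsUnitNormal (χ i) u ζ := ⟨hζ, by rwa [hev.fderiv_eq] at hn⟩
  obtain ⟨r, hr, H⟩ := exists_le_oscInt hχ' hχc hn fun θ hθ => by
    rw [hev.fderiv.fderiv_eq]
    exact (hcurv i).nondegenerate hu hν hθ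
  have hm : 0 < min r r₀ := lt_min hr hr₀
  let b : ContDiffBump u := ⟨min r r₀ / 2, min r r₀, by positivity, by linarith⟩
  have hbs : tsupport b = closedBall u (min r r₀) := b.tsupport_eq
  have hb0 : b u ≠ 0 := by
    rw [b.one_of_mem_closedBall (mem_closedBall_self b.rIn_pos.le)]
    exact one_ne_zero
  obtain ⟨c, hc0, hc⟩ := H b b.contDiff (hbs ▸ closedBall_subset_closedBall (min_le_left _ _)) hb0
  have hbr : tsupport b ⊆ closedBall u r₀ := hbs ▸ closedBall_subset_closedBall (min_le_right _ _)
  obtain ⟨f, hf1, hf2, hf⟩ := exists_fourierTransform_eq_oscInt hemb i b.continuous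
    (fun x => b.nonneg) b.hasCompactSupport (hbr.trans hrU)
  refine ⟨f, hf1, hf2, c, hc0, hc.mono fun p hp => ?_⟩
  rwa [oscInt_congr (heq.mono hbr), ← hf, finrank_euclideanSpace_fin] at hp

end TestFunctions

/-! ### Summability from the upper frame bound, and the contradiction -/

section Frame

variable {n d M : ℕ} {U : Fin M → Set (EuclideanSpace ℝ (Fin n))}
  {χ : Fin M → EuclideanSpace ℝ (Fin n) → EuclideanSpace ℝ (Fin d)}
  {Λ : Set (EuclideanSpace ℝ (Fin d))}

/-- The sum of the weights `(1 + ‖l‖)^{-n}` over the part of `Λ` in `V`. -/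
noncomputable def weightSum (n : ℕ) (Λ V : Set (EuclideanSpace ℝ (Fin d))) : ℝ≥0∞ :=
  ∑' l : Λ, V.indicator (fun l => ENNReal.ofReal (decayWeight n l)) (l : EuclideanSpace ℝ (Fin d))

theorem weightSum_mono {V W : Set (EuclideanSpace ℝ (Fin d))} (h : V ⊆ W) :
    weightSum n Λ V ≤ weightSum n Λ W :=
  ENNReal.tsum_le_tsum fun _ => indicator_le_indicator_of_subset h (fun _ => zero_le) _

theorem weightSum_union_le (V W : Set (EuclideanSpace ℝ (Fin d))) :
    weightSum n Λ (V ∪ W) ≤ weightSum n Λ V + weightSum n Λ W := by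
  rw [weightSum, weightSum, weightSum, ← ENNReal.tsum_add]
  refine ENNReal.tsum_le_tsum fun l => ?_
  by_cases h1 : (l : EuclideanSpace ℝ (Fin d)) ∈ V <;>
    by_cases h2 : (l : EuclideanSpace ℝ (Fin d)) ∈ W <;> simp [h1, h2]

theorem weightSum_lt_top_of_le {V : Set (EuclideanSpace ℝ (Fin d))}
    {g : EuclideanSpace ℝ (Fin d) → ℂ} (hg : ∑' l : Λ, ‖g l‖ₑ ^ 2 < ⊤) {K : ℝ}
    (hK : ∀ l ∈ V, decayWeight n l ≤ K * ‖g l‖ ^ 2) : weightSum n Λ V < ⊤ := by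
  refine lt_of_le_of_lt (b := ∑' l : Λ, ENNReal.ofReal K * ‖g l‖ₑ ^ 2) ?_ ?_
  · refine ENNReal.tsum_le_tsum fun l => ?_
    by_cases hl : (l : EuclideanSpace ℝ (Fin d)) ∈ V
    · rw [indicator_of_mem hl, ← ofReal_norm, ← ENNReal.ofReal_pow (norm_nonneg _),
        ← ENNReal.ofReal_mul' (by positivity)]
      exact ENNReal.ofReal_le_ofReal (hK _ hl)
    · rw [indicator_of_notMem hl]
      exact zero_le
  · rw [ENNReal.tsum_mul_left]
    exact ENNReal.mul_lt_top ENNReal.ofReal_lt_top hg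

theorem weightSum_univ_lt_top (hemb : ∀ i, IsSmoothEmbedding (U i) (χ i))
    (hcurv : ∀ i, HasNonvanishingGaussianCurvature (U i) (χ i)) (hne : (surface U χ).Nonempty)
    (hcompact : IsCompact (surface U χ))
    (hΛ : ∀ f : EuclideanSpace ℝ (Fin d) → ℂ, Integrable f (surfaceMeasure U χ) →
      MemLp f 2 (surfaceMeasure U χ) →
        ∑' l : Λ, ‖fourierTransform (surfaceMeasure U χ) f l‖ₑ ^ 2 < ⊤) :
    weightSum n Λ univ < ⊤ := by
  have hfar : ∃ T₀ : ℝ, weightSum n Λ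
      {l | ∃ T ≥ T₀, ∃ ζ ∈ sphere (0 : EuclideanSpace ℝ (Fin d)) 1, l = T • ζ} < ⊤ := by
    refine (isCompact_sphere (0 : EuclideanSpace ℝ (Fin d)) 1).induction_on
      (p := fun V => ∃ T₀ : ℝ, weightSum n Λ {l | ∃ T ≥ T₀, ∃ ζ ∈ V, l = T • ζ} < ⊤) ?_ ?_ ?_ ?_
    · exact ⟨0, by simp [weightSum]⟩
    · rintro V V' hVV ⟨T₀, hT₀⟩
      refine ⟨T₀, lt_of_le_of_lt (weightSum_mono ?_) hT₀⟩
      rintro l ⟨T, hT, ζ, hζ, rfl⟩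
      exact ⟨T, hT, ζ, hVV hζ, rfl⟩
    · rintro V V' ⟨T₀, hT₀⟩ ⟨T₁, hT₁⟩
      refine ⟨max T₀ T₁, lt_of_le_of_lt ((weightSum_mono ?_).trans (weightSum_union_le _ _))
        (ENNReal.add_lt_top.2 ⟨hT₀, hT₁⟩)⟩
      rintro l ⟨T, hT, ζ, hζ | hζ, rfl⟩
      · exact Or.inl ⟨T, (le_max_left _ _).trans hT, ζ, hζ, rfl⟩
      · exact Or.inr ⟨T, (le_max_right _ _).trans hT, ζ, hζ, rfl⟩
    · intro ζ hζ
      have hζ1 : ‖ζ‖ = 1 := mem_sphere_zero_iff_norm.1 hζ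
      obtain ⟨f, hf1, hf2, c, hc0, hc⟩ := exists_le_fourierTransform hemb hcurv hne hcompact hζ1
      obtain ⟨P, hP, Q, hQ, hPQ⟩ := eventually_prod_iff.1 hc
      obtain ⟨T₁, hT₁⟩ := eventually_atTop.1 hP
      -- Nearby `z` need not be unit vectors; `|z| > 1/2` gives `T ≤ 2 (1 + T|z|)`, whence the
      -- factor `2ⁿ`.
      have hQ2 : ∀ᶠ z in 𝓝 ζ, Q z ∧ 1 / 2 < ‖z‖ :=
        hQ.and ((continuous_norm.tendsto ζ).eventually_const_lt (by rw [hζ1]; norm_num))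
      refine ⟨{z | Q z ∧ 1 / 2 < ‖z‖}, mem_nhdsWithin_of_mem_nhds hQ2, max T₁ 1,
        weightSum_lt_top_of_le (hΛ f hf1 hf2) (K := 2 ^ n / c) ?_⟩
      rintro l ⟨T, hT, z, ⟨hz, hz2⟩, rfl⟩
      have hT1 : 1 ≤ T := (le_max_right _ _).trans hT
      have h1 := hPQ (hT₁ T ((le_max_left _ _).trans hT)) hz
      simp only at h1
      rw [decayWeight, norm_smul, Real.norm_of_nonneg (by linarith),
        inv_le_iff_one_le_mul₀ (by positivity)]
      calc (1 : ℝ) = c / c := (div_self hc0.ne').symm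
        _ ≤ (T ^ n * ‖fourierTransform (surfaceMeasure U χ) f (T • z)‖ ^ 2) / c := by gcongr
        _ ≤ ((2 * (1 + T * ‖z‖)) ^ n *
            ‖fourierTransform (surfaceMeasure U χ) f (T • z)‖ ^ 2) / c := by
          gcongr
          nlinarith
        _ = _ := by
          rw [mul_pow]
          ring
  -- Near any `ξ`, the modulated test function has transform `f^(l - ξ)`, close to `f^(0) ≠ 0`; the
  -- upper frame bound and compactness of the ball finish.
  have hnear : ∀ R : ℝ, weightSum n Λ (closedBall 0 R) < ⊤ := by
    intro R
    obtain ⟨f, hf1, hf2, hf0, -⟩ := exists_fourierTransform_decay hemb hcurv hne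
    refine (isCompact_closedBall (0 : EuclideanSpace ℝ (Fin d)) R).induction_on
      (p := fun V => weightSum n Λ V < ⊤) ?_ ?_ ?_ ?_
    · simp [weightSum]
    · exact fun V V' hVV h => lt_of_le_of_lt (weightSum_mono hVV) h
    · exact fun V V' h h' => lt_of_le_of_lt (weightSum_union_le _ _) (ENNReal.add_lt_top.2 ⟨h, h'⟩)
    · intro ξ hξ
      set c := ‖fourierTransform (surfaceMeasure U χ) f 0‖ with hc
      have hc0 : 0 < c := norm_pos_iff.2 hf0
      have hcont : Tendsto (fun l => ‖fourierTransform (surfaceMeasure U χ) f (l - ξ)‖) (𝓝 ξ)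
          (𝓝 c) := by
        have h1 : Continuous fun l => ‖fourierTransform (surfaceMeasure U χ) f (l - ξ)‖ :=
          ((continuous_fourierTransform hf1).comp (by fun_prop)).norm
        simpa using h1.tendsto ξ
      refine ⟨_, mem_nhdsWithin_of_mem_nhds (hcont.eventually_const_lt (half_lt_self hc0)),
        weightSum_lt_top_of_le (hΛ _ (integrable_modulate hf1 ξ) (memLp_modulate hf2 ξ))
          (K := ((c / 2) ^ 2)⁻¹) ?_⟩
      intro l hl
      rw [fourierTransform_modulate]
      have hl' : c / 2 < ‖fourierTransform (surfaceMeasure U χ) f (l - ξ)‖ := hl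
      calc decayWeight n l ≤ 1 := by
            rw [decayWeight]
            exact inv_le_one_of_one_le₀ (one_le_pow₀ (by linarith [norm_nonneg l]))
        _ = ((c / 2) ^ 2)⁻¹ * (c / 2) ^ 2 := by field_simp
        _ ≤ _ := by gcongr
  obtain ⟨T₀, hT₀⟩ := hfar
  refine lt_of_le_of_lt ((weightSum_mono ?_).trans (weightSum_union_le _ _))
    (ENNReal.add_lt_top.2 ⟨hT₀, hnear (max T₀ 0)⟩)
  intro l _
  rcases le_or_gt ‖l‖ (max T₀ 0) with h | h
  · exact Or.inr (by simpa using h)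
  · have hl0 : 0 < ‖l‖ := (le_max_right _ _).trans_lt h
    refine Or.inl ⟨‖l‖, ((le_max_left _ _).trans_lt h).le, ‖l‖⁻¹ • l, ?_, ?_⟩
    · rw [mem_sphere_zero_iff_norm, norm_smul, norm_inv, norm_norm, inv_mul_cancel₀ hl0.ne']
    · rw [smul_smul, mul_inv_cancel₀ hl0.ne', one_smul]

theorem not_admitsFourierFrame (hn : n ≠ 0) (hd : d = n + 1)
    (hemb : ∀ i, IsSmoothEmbedding (U i) (χ i))
    (hcurv : ∀ i, HasNonvanishingGaussianCurvature (U i) (χ i)) (hne : (surface U χ).Nonempty)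
    (hcompact : IsCompact (surface U χ)) : ¬ AdmitsFourierFrame (surfaceMeasure U χ) := by
  rintro ⟨Λ, -, A, B, hA, -, hΛ⟩
  have hsum : weightSum n Λ univ < ⊤ := weightSum_univ_lt_top hemb hcurv hne hcompact
    fun f hf1 hf2 => lt_of_le_of_lt (hΛ f hf1 hf2).2
      (ENNReal.mul_lt_top ENNReal.ofReal_lt_top (ENNReal.pow_lt_top hf2.2))
  simp only [weightSum, indicator_univ] at hsum
  obtain ⟨f, hf1, hf2, hf0, C, hC⟩ := exists_fourierTransform_decay hemb hcurv hne
  have hnorm : eLpNorm f 2 (surfaceMeasure U χ) ≠ 0 := by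
    intro h0
    rw [eLpNorm_eq_zero_iff hf2.1 two_ne_zero] at h0
    refine hf0 ?_
    rw [fourierTransform, integral_eq_zero_of_ae]
    filter_upwards [h0] with x hx
    rw [hx]
    simp
  have hC0 : 0 < C := by
    have h1 := hC 0
    have h2 : 0 < ‖fourierTransform (surfaceMeasure U χ) f 0‖ ^ 2 := by positivity
    exact pos_of_mul_pos_left (h2.trans_le h1) (decayWeight_nonneg _ _)
  -- By the lower frame bound for the modulations of `f`, this threshold bounds the translated
  -- weight sums from below, uniformly in `ξ`.
  have ha : ENNReal.ofReal A * eLpNorm f 2 (surfaceMeasure U χ) ^ 2 / ENNReal.ofReal C ≠ 0 :=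
    ENNReal.div_ne_zero.2 ⟨mul_ne_zero (by simpa using hA) (pow_ne_zero _ hnorm),
      ENNReal.ofReal_ne_top⟩
  obtain ⟨ξ, hξ⟩ := exists_tsum_decayWeight_sub_lt hn
    (by rw [finrank_euclideanSpace_fin, hd]) hsum.ne ha
  refine absurd hξ (not_lt.2 ?_)
  refine ENNReal.div_le_of_le_mul' ?_
  have h3 := (hΛ _ (integrable_modulate hf1 ξ) (memLp_modulate hf2 ξ)).1
  rw [eLpNorm_modulate] at h3
  refine h3.trans ?_
  rw [← ENNReal.tsum_mul_left]
  refine ENNReal.tsum_le_tsum fun l => ?_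
  rw [fourierTransform_modulate, ← ofReal_norm, ← ENNReal.ofReal_pow (norm_nonneg _),
    ← ENNReal.ofReal_mul hC0.le]
  exact ENNReal.ofReal_le_ofReal (hC _)

end Frame

end FourierFrame

theorem corollary1p2 (d : ℕ) (hd : 2 ≤ d) (M : ℕ)
    (U : Fin M → Set (EuclideanSpace ℝ (Fin (d - 1))))
    (χ : Fin M → EuclideanSpace ℝ (Fin (d - 1)) → EuclideanSpace ℝ (Fin d))
    (hemb : ∀ i, FourierFrame.IsSmoothEmbedding (U i) (χ i))
    (hcurv : ∀ i, FourierFrame.HasNonvanishingGaussianCurvature (U i) (χ i))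
    (hne : (FourierFrame.surface U χ).Nonempty)
    (hcompact : IsCompact (FourierFrame.surface U χ)) :
    ¬ FourierFrame.AdmitsFourierFrame (FourierFrame.surfaceMeasure U χ) :=
  FourierFrame.not_admitsFourierFrame (by omega) (by omega) hemb hcurv hne hcompact
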